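/- Let $A$ be a real $k\times k$ matrix whose eigenvalues are all real and lie in $[-1,1]$, and let $f:\mathbb{R}\to\mathbb{R}$ be continuous on $[-1,1]$. Let $T_n$ be the Chebyshev polynomials of the first kind, $$\alpha_n[f]=\frac{2}{\pi}\int_{-1}^{1}\frac{f(t)\,T_n(t)}{\sqrt{1-t^2}}\,dt ,\qquad \mathcal{S}_N(f)(A)=\tfrac12\,\alpha_0[f]\,I+\sum_{n=1}^{N}\alpha_n[f]\,T_n(A).$$ Suppose that the matrix Chebyshev expansion of $f$ at $A$ converges absolutely, i.e. $\sum_{n\ge 1}\|\alpha_n[f]\,T_n(A)\|<\infty$ for some sub-multiplicative matrix norm $\|\cdot\|$ (the choice of the norm does not matter). Then its limit $\mathcal{S}_\infty(f)(A)=\lim_{N\to\infty}\mathcal{S}_N(f)(A)$ equals $f(A)$, for each of the following two standard definitions of $f(A)$. 1. (Jordan form.) Let $A=Z^{-1}JZ$ be any Jordan form of $A$, with Jordan blocks $J_i$ of size $k_i$ and eigenvalue $\lambda_i$ (ones on the superdiagonal), and let $m=\max_i k_i$. If $f$ has $m-1$ derivatives on $[-1,1]$ (one-sided at $\pm1$),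 then $\mathcal{S}_\infty(f)(A)=f(A):=Z^{-1}f(J)Z$, where $f(J)$ is block diagonal with the upper triangular blocks $f(J_i)$ whose entries are $f(J_i)_{p,q}=\dfrac{f^{(q-p)}(\lambda_i)}{(q-p)!}$ for $1\le p\le q\le k_i$ and $0$ for $p>q$. 2. (Taylor series.) If $f$ is given by its Taylor series around $0$ on $|x|<r$ for some $r$ (possibly $\infty$) that is larger than the spectral radius of $A$, then the series $\sum_{n\ge0}\frac{f^{(n)}(0)}{n!}A^n$ converges and $\mathcal{S}_\infty(f)(A)=f(A):=\sum_{n\ge0}\frac{f^{(n)}(0)}{n!}A^n$. -/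

import Mathlib

open Set Filter Topology MeasureTheory
open scoped Nat ENNReal

noncomputable section

namespace MatrixChebyshev

/-- The Chebyshev coefficient `α_n[f] = (2/π) ∫_{-1}^1 f(t) T_n(t) / √(1 - t²) dt`. -/
def coeff (f : ℝ → ℝ) (n : ℕ) : ℝ :=
  2 / Real.pi *
    ∫ t in (-1 : ℝ)..1, f t * (Polynomial.Chebyshev.T ℝ (n : ℤ)).eval t / √(1 - t ^ 2)

/-- The `n`-th term `α_n[f] T_n(A)` of the matrix Chebyshev series. The term with `n = 0` is
halved (this is the meaning of the dashed sum). -/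
def term {k : ℕ} (f : ℝ → ℝ) (A : Matrix (Fin k) (Fin k) ℝ) (n : ℕ) :
    Matrix (Fin k) (Fin k) ℝ :=
  (if n = 0 then coeff f 0 / 2 else coeff f n) •
    Polynomial.aeval A (Polynomial.Chebyshev.T ℝ (n : ℤ))

/-- The truncated matrix Chebyshev expansion `S_N(f)(A)`, with terms `n = 0, …, N`. -/
def partialSum {k : ℕ} (f : ℝ → ℝ) (A : Matrix (Fin k) (Fin k) ℝ) (N : ℕ) :
    Matrix (Fin k) (Fin k) ℝ :=
  ∑ n ∈ Finset.range (N + 1), term f A n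

/-- The `n × n` Jordan block with eigenvalue `μ`, with ones on the superdiagonal. -/
def jordanBlock (n : ℕ) (μ : ℝ) : Matrix (Fin n) (Fin n) ℝ :=
  Matrix.of fun i j => if i = j then μ else if (i : ℕ) + 1 = (j : ℕ) then 1 else 0

/-- The value of `f` on a Jordan block: upper triangular, with `f^{(j)}(μ) / j!` on the `j`-th
superdiagonal. Derivatives are taken within `[-1, 1]`, so they are one-sided at `±1`. -/
def functionOnJordanBlock (f : ℝ → ℝ) (n : ℕ) (μ : ℝ) : Matrix (Fin n) (Fin n) ℝ :=
  Matrix.of fun i j =>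
    if i ≤ j then
      iteratedDerivWithin ((j : ℕ) - (i : ℕ)) f (Icc (-1) 1) μ / (((j : ℕ) - (i : ℕ)) ! : ℝ)
    else 0

/-- A real Jordan form `A = Z⁻¹ J Z`, where `J` is block diagonal with Jordan blocks. The rows of
`Z` are indexed by the pairs (block, position within the block). -/
structure JordanForm {k : ℕ} (A : Matrix (Fin k) (Fin k) ℝ) where
  /-- the number of blocks -/
  numBlocks : ℕ
  /-- the sizes of the blocks -/
  size : Fin numBlocks → ℕ
  size_pos : ∀ i, 0 < size i
  /-- the eigenvalues of the blocks -/
  eigenvalue : Fin numBlocks → ℝ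
  /-- the transition matrix -/
  Z : Matrix ((i : Fin numBlocks) × Fin (size i)) (Fin k) ℝ
  /-- the inverse of the transition matrix -/
  Zinv : Matrix (Fin k) ((i : Fin numBlocks) × Fin (size i)) ℝ
  Z_mul_Zinv : Z * Zinv = 1
  Zinv_mul_Z : Zinv * Z = 1
  eq_conj : A = Zinv * Matrix.blockDiagonal' (fun i => jordanBlock (size i) (eigenvalue i)) * Z

/-- The size of the largest Jordan block (zero only for the empty matrix). -/
def JordanForm.maxSize {k : ℕ} {A : Matrix (Fin k) (Fin k) ℝ} (D : JordanForm A) : ℕ :=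
  Finset.univ.sup D.size

/-- The matrix function `f(A) = Z⁻¹ f(J) Z`, computed from a Jordan form of `A`. -/
def JordanForm.apply {k : ℕ} {A : Matrix (Fin k) (Fin k) ℝ} (D : JordanForm A) (f : ℝ → ℝ) :
    Matrix (Fin k) (Fin k) ℝ :=
  D.Zinv *
    Matrix.blockDiagonal' (fun i => functionOnJordanBlock f (D.size i) (D.eigenvalue i)) * D.Z

/-- `f` has (at least) `d` derivatives on `[-1, 1]`, one-sided at the end points; the last one
need not be continuous. -/
def HasDerivatives (f : ℝ → ℝ) (d : ℕ) : Prop :=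
  ∀ j < d, DifferentiableOn ℝ (iteratedDerivWithin j f (Icc (-1) 1)) (Icc (-1) 1)

end MatrixChebyshev

end

namespace MatrixChebyshev

/-! Write N = A - μ and let v satisfy N^(l+1) v = 0, N^l v ≠ 0. Expanding T_n at μ, the matrix
series applied to v splits into the scalar series Σ α_n T_n^(d)(μ)/d!, d ≤ l, along the vectors N^d
v. Absolute convergence of the matrix series forces absolute convergence of these scalar series
(`summable_halvedCoeff_mul_derivT`). The analytic core, `hasSum_halvedCoeff_mul_derivT`, says that
they then sum to f^(d)(μ)/d!. Both definitions of f(A) act on v by the resulting formula, and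
generalized eigenvectors span.

For the core at order 0, the symmetrized translate (g(θ+t) + g(θ-t))/2 of g = f ∘ cos, with μ = cos
θ, has coefficients α_n T_n(μ). These are summable, so its Chebyshev series converges uniformly, and
t = 0 gives f(μ).

For |μ| < 1, convergence of the orders up to d ≥ 1 gives Σ n^(d-1) |α_n| < ∞. This allows d - 1
termwise differentiations near μ, one too few. The last is done at μ alone: in the angle variable,
the odd part about θ is a sine series that can be differentiated termwise at t = 0. The Chebyshev
equation trades two derivatives for a factor n², which reduces every order to 1 or 2.

At μ = ±1, |T_n^(d)| on [-1, 1] is largest at the end points, so convergence there is uniform on the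
interval. -/

open Polynomial Polynomial.Chebyshev

/-! ### Termwise differentiation of series -/

/-- Termwise differentiation of a series on a convex set, possibly at a boundary point. -/
theorem hasDerivWithinAt_tsum_of_convex {s : Set ℝ} (hs : Convex ℝ s) {g g' : ℕ → ℝ → ℝ}
    {u : ℕ → ℝ} (hu : Summable u) (hg : ∀ n, ∀ y ∈ s, HasDerivWithinAt (g n) (g' n y) s y)
    (hg' : ∀ n, ∀ y ∈ s, |g' n y| ≤ u n) (hsum : ∀ y ∈ s, Summable fun n => g n y)
    {x : ℝ} (hx : x ∈ s) :
    HasDerivWithinAt (fun y => ∑' n, g n y) (∑' n, g' n x) s x := by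
  rw [hasDerivWithinAt_iff_tendsto_slope]
  have key : Tendsto (fun y => ∑' n, slope (g n) x y) (𝓝[s \ {x}] x) (𝓝 (∑' n, g' n x)) := by
    refine tendsto_tsum_of_dominated_convergence hu (fun n => ?_) ?_
    · exact (hasDerivWithinAt_iff_tendsto_slope.1 (hg n x hx))
    · filter_upwards [self_mem_nhdsWithin] with y hy n
      -- The mean value inequality on the convex set bounds each slope by `u n`, so dominated
      -- convergence applies to the slopes themselves.
      have h := hs.norm_image_sub_le_of_norm_hasDerivWithin_le (hg n) (hg' n) hx hy.1
      have hne : 0 < |y - x| := abs_pos.2 (sub_ne_zero.2 hy.2)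
      rw [slope_def_field, Real.norm_eq_abs, abs_div, div_le_iff₀ hne]
      simpa using h
  refine key.congr' ?_
  filter_upwards [self_mem_nhdsWithin] with y hy
  rw [slope_def_field, ← (hsum y hy.1).tsum_sub (hsum x hx), ← tsum_div_const]
  simp only [slope_def_field]

/-- If the odd part of `h` about `θ` is the sum of a sine series that can be differentiated
termwise, then its derived series at `0` sums to the derivative of `h`. -/
theorem hasSum_of_odd_part_sine_series {b : ℕ → ℝ} {h : ℝ → ℝ} {h' θ : ℝ}
    (hb : Summable fun n : ℕ => n * b n) (hh : HasDerivAt h h' θ)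
    (hsum : ∀ᶠ t in 𝓝 (0 : ℝ),
      HasSum (fun n : ℕ => b n * Real.sin (n * t)) ((h (θ + t) - h (θ - t)) / 2)) :
    HasSum (fun n : ℕ => n * b n) h' := by
  have h1 : HasDerivAt (fun t : ℝ => ∑' n : ℕ, b n * Real.sin (n * t))
      (∑' n : ℕ, b n * (Real.cos (n * 0) * n)) 0 := by
    refine hasDerivAt_tsum (u := fun n : ℕ => |n * b n|) (y₀ := 0)
      (g' := fun (n : ℕ) t => b n * (Real.cos (n * t) * n)) hb.abs (fun n t => ?_)
      (fun n t => ?_) (by simp) 0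
    · have := ((hasDerivAt_id t).const_mul (n : ℝ)).sin.const_mul (b n)
      simpa using this
    · rw [Real.norm_eq_abs, abs_mul, abs_mul, abs_mul]
      have := Real.abs_cos_le_one (n * t)
      have h0 : 0 ≤ |b n| * |(n : ℝ)| := by positivity
      nlinarith
  -- A symmetric difference quotient needs differentiability of `h` only at `θ`.
  have h2 : HasDerivAt (fun t => (h (θ + t) - h (θ - t)) / 2) h' 0 := by
    have ha : HasDerivAt (fun t => h (θ + t)) h' 0 := by
      have := HasDerivAt.comp_const_add θ 0 (by simpa using hh); simpa using this
    have hc : HasDerivAt (fun t => h (θ - t)) (-h') 0 := by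
      have := HasDerivAt.comp_const_sub θ 0 (by simpa using hh); simpa using this
    exact ((ha.sub hc).div_const 2).congr_deriv (by ring)
  have h3 : (fun t : ℝ => ∑' n : ℕ, b n * Real.sin (n * t)) =ᶠ[𝓝 0]
      fun t => (h (θ + t) - h (θ - t)) / 2 := by
    filter_upwards [hsum] with t ht using ht.tsum_eq
  have h4 := (h1.congr_of_eventuallyEq h3.symm).unique h2
  rw [← h4]
  convert hb.hasSum using 2
  ext n
  simp [mul_comm]

/-! ### Pointwise sums of scalar Chebyshev series -/

/-- The coefficients of the Chebyshev expansion, where the one with `n = 0` is halved. -/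
noncomputable def halvedCoeff (f : ℝ → ℝ) (n : ℕ) : ℝ :=
  if n = 0 then coeff f 0 / 2 else coeff f n

theorem term_eq_smul {k : ℕ} (f : ℝ → ℝ) (A : Matrix (Fin k) (Fin k) ℝ) (n : ℕ) :
    term f A n = halvedCoeff f n • aeval A (T ℝ (n : ℤ)) := rfl

theorem coeff_eq_integral_measureT (f : ℝ → ℝ) (n : ℕ) :
    coeff f n = 2 / Real.pi * ∫ t, f t * (T ℝ (n : ℤ)).eval t ∂measureT := by
  rw [coeff, integral_measureT]
  simp only [div_eq_mul_inv, Real.sqrt_inv]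

theorem coeff_eq_integral_cos (f : ℝ → ℝ) (n : ℕ) :
    coeff f n = 2 / Real.pi * ∫ θ in (0 : ℝ)..Real.pi, f (Real.cos θ) * Real.cos (n * θ) := by
  rw [coeff_eq_integral_measureT, integral_measureT_eq_integral_cos]
  simp [T_real_cos]

theorem abs_eval_T_le_one (n : ℕ) {x : ℝ} (hx : x ∈ Icc (-1 : ℝ) 1) :
    |(T ℝ (n : ℤ)).eval x| ≤ 1 :=
  abs_eval_T_real_le_one n (abs_le.2 hx)

/-- The recurrence 2 X T_n = T_(n+1) + T_(n-1), with n ranging over ℤ, carries orthogonality from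
T_n to X^m T_n; n = 0 then gives the monomials. -/
theorem integral_mul_eval_eq_zero {e : ℝ → ℝ} (he : ContinuousOn e (Icc (-1) 1))
    (h0 : ∀ n : ℕ, ∫ x, e x * (T ℝ (n : ℤ)).eval x ∂measureT = 0) (p : ℝ[X]) :
    ∫ x, e x * p.eval x ∂measureT = 0 := by
  have hint : ∀ q : ℝ[X], Integrable (fun x => e x * q.eval x) measureT := fun q =>
    integrable_measureT (he.mul q.continuous.continuousOn)
  have hZ : ∀ n : ℤ, ∫ x, e x * (T ℝ n).eval x ∂measureT = 0 := fun n => by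
    rw [← T_natAbs]; exact h0 _
  suffices H : ∀ m : ℕ, ∀ n : ℤ, ∫ x, e x * (X ^ m * T ℝ n).eval x ∂measureT = 0 by
    induction p using Polynomial.induction_on' with
    | add p q hp hq =>
      simp only [eval_add, mul_add]
      rw [integral_add (hint p) (hint q), hp, hq, add_zero]
    | monomial m a =>
      have := H m 0
      simp only [T_zero, mul_one, eval_pow, eval_X] at this
      simp only [eval_monomial, mul_left_comm _ a]
      rw [integral_const_mul, this, mul_zero]
  intro m
  induction m with
  | zero => intro n; simpa using hZ n
  | succ m ih =>
    intro n
    have h1 : ∀ x, e x * (X ^ (m + 1) * T ℝ n).eval x =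
        (e x * (X ^ m * T ℝ (n + 1)).eval x + e x * (X ^ m * T ℝ (n - 1)).eval x) / 2 := by
      intro x
      rw [T_add_one]
      simp only [eval_mul, eval_sub, eval_pow, eval_X, eval_ofNat]
      ring
    simp only [h1]
    rw [integral_div, integral_add (hint _) (hint _), ih, ih]
    simp

/-- By Weierstrass approximation ∫ e² = ∫ e (e - p) is arbitrarily small, so the continuous function
e ∘ cos vanishes on [0, π]. -/
theorem eqOn_zero_of_integral_mul_T_eq_zero {e : ℝ → ℝ} (he : ContinuousOn e (Icc (-1) 1))
    (h0 : ∀ n : ℕ, ∫ x, e x * (T ℝ (n : ℤ)).eval x ∂measureT = 0) :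
    ∀ x ∈ Icc (-1 : ℝ) 1, e x = 0 := by
  have hIcc : ∀ᵐ x ∂measureT, x ∈ Icc (-1 : ℝ) 1 := by
    filter_upwards [ae_restrict_mem measurableSet_Ioc] with x hx using ⟨hx.1.le, hx.2⟩
  have hsq : ∫ x, e x * e x ∂measureT = 0 := by
    have hi : Integrable (fun x => |e x|) measureT := integrable_measureT he.abs
    set M := ∫ x, |e x| ∂measureT
    have hM : 0 ≤ M := integral_nonneg fun x => abs_nonneg _
    refine abs_nonpos_iff.1 (le_of_forall_pos_le_add fun ε hε => ?_)
    -- The `+ 1` keeps the tolerance meaningful when `M = 0`.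
    obtain ⟨p, hp⟩ := exists_polynomial_near_of_continuousOn (-1) 1 e he (ε / (M + 1))
      (by positivity)
    have hpe := integral_mul_eval_eq_zero he h0 p
    have h1 : ∫ x, e x * e x ∂measureT = ∫ x, e x * (e x - p.eval x) ∂measureT := by
      simp only [mul_sub]
      rw [integral_sub (f := fun x => e x * e x) (g := fun x => e x * p.eval x)
        (integrable_measureT (he.mul he))
        (integrable_measureT (he.mul p.continuous.continuousOn)), hpe, sub_zero]
    rw [h1, ← Real.norm_eq_abs]
    calc _ ≤ ∫ x, |e x| * (ε / (M + 1)) ∂measureT := by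
          refine norm_integral_le_of_norm_le (hi.mul_const _) ?_
          filter_upwards [hIcc] with x hx
          rw [Real.norm_eq_abs, abs_mul, abs_sub_comm]
          gcongr
          exact (hp x hx).le
      _ = M * (ε / (M + 1)) := integral_mul_const _ _
      _ ≤ 0 + ε := by
          rw [zero_add, mul_div_assoc', div_le_iff₀ (by positivity)]
          nlinarith
  rw [integral_measureT_eq_integral_cos] at hsq
  have hc : Continuous fun θ => e (Real.cos θ) :=
    he.comp_continuous Real.continuous_cos Real.cos_mem_Icc
  intro x hx
  by_contra hne
  refine absurd hsq (ne_of_gt ?_)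
  refine intervalIntegral.integral_pos Real.pi_pos (hc.mul hc).continuousOn
    (fun θ _ => mul_self_nonneg _) ⟨Real.arccos x, ⟨Real.arccos_nonneg x, Real.arccos_le_pi x⟩, ?_⟩
  rw [Real.cos_arccos hx.1 hx.2]
  exact mul_self_pos.2 hne

theorem summable_mul_eval_T {c : ℕ → ℝ} (hc : Summable c) {x : ℝ} (hx : x ∈ Icc (-1 : ℝ) 1) :
    Summable fun n => c n * (T ℝ (n : ℤ)).eval x := by
  refine Summable.of_norm_bounded hc.abs fun n => ?_
  rw [Real.norm_eq_abs, abs_mul]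
  exact mul_le_of_le_one_right (abs_nonneg _) (abs_eval_T_le_one n hx)

instance : IsFiniteMeasure measureT := by
  have : Integrable (fun _ : ℝ => (1 : ℝ)) measureT := integrable_measureT continuousOn_const
  exact (integrable_const_iff_isFiniteMeasure one_ne_zero).1 this

theorem integral_tsum_mul_eval_T {c : ℕ → ℝ} (hc : Summable c) (m : ℕ) :
    ∫ x, (∑' n, c n * (T ℝ (n : ℤ)).eval x) * (T ℝ (m : ℤ)).eval x ∂measureT =
      c m * ∫ x, (T ℝ (m : ℤ)).eval x * (T ℝ (m : ℤ)).eval x ∂measureT := by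
  have hIcc : ∀ᵐ x ∂measureT, x ∈ Icc (-1 : ℝ) 1 := by
    filter_upwards [ae_restrict_mem measurableSet_Ioc] with x hx using ⟨hx.1.le, hx.2⟩
  have h := hasSum_integral_of_dominated_convergence (μ := measureT)
    (F := fun (n : ℕ) x => c n * (T ℝ (n : ℤ)).eval x * (T ℝ (m : ℤ)).eval x)
    (f := fun x => (∑' n, c n * (T ℝ (n : ℤ)).eval x) * (T ℝ (m : ℤ)).eval x)
    (fun n _ => |c n|)
    (fun n => ((by fun_prop : Continuous _)).aestronglyMeasurable)
    (fun n => by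
      filter_upwards [hIcc] with x hx
      rw [Real.norm_eq_abs, abs_mul, abs_mul, mul_assoc]
      exact mul_le_of_le_one_right (abs_nonneg _) (mul_le_one₀ (abs_eval_T_le_one n hx)
        (abs_nonneg _) (abs_eval_T_le_one m hx)))
    (ae_of_all _ fun _ => hc.abs) (integrable_const _)
    (by
      filter_upwards [hIcc] with x hx
      exact (summable_mul_eval_T hc hx).hasSum.mul_right _)
  refine h.unique ?_
  simp only [mul_assoc, integral_const_mul]
  refine hasSum_single m fun n hn => ?_
  rw [integral_eval_T_real_mul_eval_T_real_measureT_of_ne hn, mul_zero]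

theorem halvedCoeff_mul_integral (f : ℝ → ℝ) (m : ℕ) :
    halvedCoeff f m * ∫ x, (T ℝ (m : ℤ)).eval x * (T ℝ (m : ℤ)).eval x ∂measureT =
      ∫ x, f x * (T ℝ (m : ℤ)).eval x ∂measureT := by
  have := Real.pi_ne_zero
  rw [halvedCoeff]
  split_ifs with h
  · subst h
    rw [Nat.cast_zero, integral_eval_T_real_mul_self_measureT_zero, coeff_eq_integral_measureT]
    rw [Nat.cast_zero]
    field_simp
  · rw [integral_T_real_mul_self_measureT_of_ne_zero h, coeff_eq_integral_measureT]
    field_simp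

/-- A continuous function whose Chebyshev coefficients are absolutely summable is the sum of its
Chebyshev series. -/
theorem hasSum_chebyshev_of_summable_coeff {f : ℝ → ℝ} (hf : ContinuousOn f (Icc (-1) 1))
    (hc : Summable (halvedCoeff f)) {x : ℝ} (hx : x ∈ Icc (-1 : ℝ) 1) :
    HasSum (fun n => halvedCoeff f n * (T ℝ (n : ℤ)).eval x) (f x) := by
  set S : ℝ → ℝ := fun x => ∑' n, halvedCoeff f n * (T ℝ (n : ℤ)).eval x
  have hS : ContinuousOn S (Icc (-1) 1) := by
    refine continuousOn_tsum (fun n => by fun_prop) hc.abs fun n y hy => ?_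
    rw [Real.norm_eq_abs, abs_mul]
    exact mul_le_of_le_one_right (abs_nonneg _) (abs_eval_T_le_one n hy)
  have h0 := eqOn_zero_of_integral_mul_T_eq_zero (hf.sub hS) (fun m => by
    simp only [Pi.sub_apply, sub_mul]
    rw [integral_sub (integrable_measureT (by fun_prop)) (integrable_measureT (by fun_prop)),
      integral_tsum_mul_eval_T hc, halvedCoeff_mul_integral, sub_self]) x hx
  rw [sub_eq_zero.1 h0]
  exact (summable_mul_eval_T hc hx).hasSum

/-- Unfold to a full period, shift by `θ`, and fold back: evenness of `g` cancels the sine part of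
cos(n(u - θ)). -/
theorem integral_symm_translate_mul_cos {g : ℝ → ℝ} (hg : Continuous g) (hev : ∀ t, g (-t) = g t)
    (hper : Function.Periodic g (2 * Real.pi)) (θ : ℝ) (n : ℕ) :
    ∫ t in (0 : ℝ)..Real.pi, (g (θ + t) + g (θ - t)) / 2 * Real.cos (n * t) =
      Real.cos (n * θ) * ∫ t in (0 : ℝ)..Real.pi, g t * Real.cos (n * t) := by
  have hfold : ∀ F : ℝ → ℝ, Continuous F → ∫ t in (0 : ℝ)..Real.pi, (F t + F (-t)) =
      ∫ t in -Real.pi..Real.pi, F t := by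
    intro F hF
    rw [intervalIntegral.integral_add (hF.intervalIntegrable _ _)
      ((by fun_prop : Continuous fun t => F (-t)).intervalIntegrable _ _),
      intervalIntegral.integral_comp_neg, neg_zero, add_comm,
      intervalIntegral.integral_add_adjacent_intervals (hF.intervalIntegrable _ _)
        (hF.intervalIntegrable _ _)]
  have hcosper : Function.Periodic (fun u => g u * Real.cos (n * (u - θ))) (2 * Real.pi) := by
    intro u
    have : (n : ℝ) * (u + 2 * Real.pi - θ) = n * (u - θ) + n * (2 * Real.pi) := by ring
    simp only [this, Real.cos_add_nat_mul_two_pi, hper u]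
  calc _ = ∫ t in (0 : ℝ)..Real.pi, (g (θ + t) * Real.cos (n * t) / 2 +
          g (θ + -t) * Real.cos (n * -t) / 2) := by
        refine intervalIntegral.integral_congr fun t _ => ?_
        simp only [mul_neg, Real.cos_neg, ← sub_eq_add_neg]
        ring
    _ = ∫ t in -Real.pi..Real.pi, g (θ + t) * Real.cos (n * t) / 2 :=
        hfold (fun t => g (θ + t) * Real.cos (n * t) / 2) (by fun_prop)
    _ = (∫ t in -Real.pi..Real.pi, g (θ + t) * Real.cos (n * (θ + t - θ))) / 2 := by
        rw [intervalIntegral.integral_div]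
        simp only [add_sub_cancel_left]
    _ = (∫ u in (θ + -Real.pi)..(θ + Real.pi), g u * Real.cos (n * (u - θ))) / 2 := by
        rw [intervalIntegral.integral_comp_add_left (fun u => g u * Real.cos (n * (u - θ)))]
    _ = (∫ u in -Real.pi..Real.pi, g u * Real.cos (n * (u - θ))) / 2 := by
        have := hcosper.intervalIntegral_add_eq (θ + -Real.pi) (-Real.pi)
        rw [show θ + -Real.pi + 2 * Real.pi = θ + Real.pi by ring,
          show -Real.pi + 2 * Real.pi = Real.pi by ring] at this
        rw [this]
    _ = (∫ u in (0 : ℝ)..Real.pi, (g u * Real.cos (n * (u - θ)) +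
          g (-u) * Real.cos (n * (-u - θ)))) / 2 := by
        rw [hfold (fun u => g u * Real.cos (n * (u - θ))) (by fun_prop)]
    _ = _ := by
        rw [← intervalIntegral.integral_const_mul, ← intervalIntegral.integral_div]
        refine intervalIntegral.integral_congr fun u _ => ?_
        simp only [hev, mul_sub, mul_neg, Real.cos_sub, Real.cos_neg, Real.sin_neg]
        ring

/-- If the Chebyshev series of a continuous function converges absolutely at a point, then it sums
to the value of the function there. -/
theorem hasSum_chebyshev_of_summable_term {f : ℝ → ℝ} (hf : ContinuousOn f (Icc (-1) 1))
    {x : ℝ} (hx : x ∈ Icc (-1 : ℝ) 1)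
    (hc : Summable fun n => halvedCoeff f n * (T ℝ (n : ℤ)).eval x) :
    HasSum (fun n => halvedCoeff f n * (T ℝ (n : ℤ)).eval x) (f x) := by
  set g : ℝ → ℝ := fun t => f (Real.cos t)
  have hg : Continuous g := hf.comp_continuous Real.continuous_cos Real.cos_mem_Icc
  set θ := Real.arccos x
  have hθ : Real.cos θ = x := Real.cos_arccos hx.1 hx.2
  -- Translation in the angle multiplies the n-th coefficient by T_n(x), so the given series at `x`
  -- becomes the series of `q` at 1. The coefficients of `f` itself need not be summable.
  set q : ℝ → ℝ := fun y => (g (θ + Real.arccos y) + g (θ - Real.arccos y)) / 2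
  have hq : Continuous q := by
    have := Real.continuous_arccos
    fun_prop
  have hcoeff : ∀ n, coeff q n = coeff f n * (T ℝ (n : ℤ)).eval x := by
    intro n
    have h1 : ∫ t in (0 : ℝ)..Real.pi, q (Real.cos t) * Real.cos (n * t) =
        ∫ t in (0 : ℝ)..Real.pi, (g (θ + t) + g (θ - t)) / 2 * Real.cos (n * t) := by
      refine intervalIntegral.integral_congr fun t ht => ?_
      rw [uIcc_of_le Real.pi_pos.le] at ht
      simp only [q, Real.arccos_cos ht.1 ht.2]
    rw [coeff_eq_integral_cos, h1, integral_symm_translate_mul_cos hg (by simp [g])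
      (fun t => by simp [g]), coeff_eq_integral_cos, ← hθ, T_real_cos]
    simp only [g, Int.cast_natCast]
    ring
  have hh : ∀ n, halvedCoeff q n = halvedCoeff f n * (T ℝ (n : ℤ)).eval x := by
    intro n
    unfold halvedCoeff
    split_ifs with h
    · rw [hcoeff, h]; simp
    · exact hcoeff n
  have h1 := hasSum_chebyshev_of_summable_coeff hq.continuousOn
    (by rwa [show halvedCoeff q = _ from funext hh]) (right_mem_Icc.2 (by norm_num : (-1 : ℝ) ≤ 1))
  simpa [hh, q, g, hθ] using h1

/-! ### Derivatives of Chebyshev polynomials and decay of coefficients -/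

/-- The value at `x` of the `d`-th derivative of the Chebyshev polynomial `T_n`. -/
noncomputable def derivT (d n : ℕ) (x : ℝ) : ℝ :=
  (derivative^[d] (T ℝ (n : ℤ))).eval x

theorem derivT_zero (n : ℕ) (x : ℝ) : derivT 0 n x = (T ℝ (n : ℤ)).eval x := rfl

theorem hasDerivAt_derivT (d n : ℕ) (x : ℝ) : HasDerivAt (derivT d n) (derivT (d + 1) n x) x := by
  have := (derivative^[d] (T ℝ (n : ℤ))).hasDerivAt x
  rwa [← Function.iterate_succ_apply' derivative d] at this

theorem derivT_ode (d n : ℕ) (x : ℝ) :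
    (1 - x ^ 2) * derivT (d + 2) n x =
      (2 * d + 1) * x * derivT (d + 1) n x - ((n : ℝ) ^ 2 - d ^ 2) * derivT d n x := by
  have := one_sub_X_sq_mul_iterate_derivative_T_eval (R := ℝ) n d x
  simpa only [derivT, Int.cast_natCast] using this

theorem derivT_one_cos (n : ℕ) (θ : ℝ) :
    derivT 1 n (Real.cos θ) * Real.sin θ = n * Real.sin (n * θ) := by
  have := U_real_cos θ ((n : ℤ) - 1)
  simp only [derivT, Function.iterate_one, T_derivative_eq_U, eval_mul,
    Int.cast_natCast] at this ⊢
  rw [mul_assoc, this]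
  simp

theorem derivT_zero_cos (n : ℕ) (θ : ℝ) : derivT 0 n (Real.cos θ) = Real.cos (n * θ) := by
  simp [derivT_zero, T_real_cos]

theorem derivT_succ_zero (d : ℕ) (x : ℝ) : derivT (d + 1) 0 x = 0 := by
  simp [derivT, Function.iterate_succ_apply]

theorem exists_arg {x : ℝ} (hx : |x| < 1) :
    ∃ θ, Real.cos θ = x ∧ 0 < Real.sin θ ∧ Real.sin θ ^ 2 = 1 - x ^ 2 := by
  obtain ⟨h1, h2⟩ := abs_lt.1 hx
  have hc := Real.cos_arccos h1.le h2.le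
  refine ⟨Real.arccos x, hc, Real.sin_pos_of_pos_of_lt_pi (Real.arccos_pos.2 h2)
    (Real.arccos_lt_pi.2 h1), ?_⟩
  rw [Real.sin_sq, hc]

/-- Inside `(-1, 1)` the `d`-th derivatives of `T_n` grow at most like `n ^ d`. -/
theorem exists_abs_derivT_le {ρ : ℝ} (h0 : 0 ≤ ρ) (hρ : ρ < 1) (d : ℕ) :
    ∃ C, 0 ≤ C ∧ ∀ n : ℕ, ∀ x, |x| ≤ ρ → |derivT d n x| ≤ C * n ^ d := by
  have hpos : 0 < 1 - ρ ^ 2 := by nlinarith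
  have hsq : ∀ x : ℝ, |x| ≤ ρ → 1 - ρ ^ 2 ≤ 1 - x ^ 2 := fun x hx => by
    have := sq_le_sq' (by linarith [abs_nonneg x]) hx
    rw [sq_abs] at this; linarith
  induction d using Nat.twoStepInduction with
  | zero =>
    refine ⟨1, zero_le_one, fun n x hx => ?_⟩
    have := abs_eval_T_le_one n (abs_le.1 (hx.trans hρ.le))
    simpa [derivT_zero] using this
  | one =>
    refine ⟨1 / (1 - ρ ^ 2), by positivity, fun n x hx => ?_⟩
    obtain ⟨θ, rfl, hs, hs2⟩ := exists_arg (hx.trans_lt hρ)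
    have h1 := congrArg abs (derivT_one_cos n θ)
    rw [abs_mul, abs_mul, abs_of_pos hs, Nat.abs_cast] at h1
    have h2 : |derivT 1 n (Real.cos θ)| * Real.sin θ ≤ n := by
      rw [h1]; exact mul_le_of_le_one_right (by positivity) (Real.abs_sin_le_one _)
    have h3 : 1 - ρ ^ 2 ≤ Real.sin θ := by
      have := hsq _ hx
      have := Real.sin_le_one θ
      nlinarith
    rw [pow_one, one_div, inv_mul_eq_div, le_div_iff₀ hpos]
    exact (mul_le_mul_of_nonneg_left h3 (abs_nonneg _)).trans h2
  | more d ih0 ih1 =>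
    obtain ⟨C0, hC0, h0'⟩ := ih0
    obtain ⟨C1, hC1, h1'⟩ := ih1
    -- Solve `derivT_ode` for the order d + 2, using 1 - x² ≥ 1 - ρ² and n² + d² ≤ (1 + d²) n². The
    -- last bound needs n ≥ 1, hence the separate case n = 0.
    refine ⟨((2 * d + 1) * C1 + (1 + d ^ 2) * C0) / (1 - ρ ^ 2), by positivity, fun n x hx => ?_⟩
    rcases Nat.eq_zero_or_pos n with rfl | hn
    · simp [derivT_succ_zero]
    have hn1 : (1 : ℝ) ≤ n := by exact_mod_cast hn
    rw [div_mul_eq_mul_div, le_div_iff₀ hpos]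
    have hx1 : |x| ≤ 1 := hx.trans hρ.le
    calc |derivT (d + 2) n x| * (1 - ρ ^ 2) ≤ |derivT (d + 2) n x| * (1 - x ^ 2) :=
          mul_le_mul_of_nonneg_left (hsq x hx) (abs_nonneg _)
      _ = |(1 - x ^ 2) * derivT (d + 2) n x| := by
          rw [abs_mul, abs_of_pos (hpos.trans_le (hsq x hx)), mul_comm]
      _ ≤ |(2 * d + 1) * x * derivT (d + 1) n x| + |((n : ℝ) ^ 2 - d ^ 2) * derivT d n x| := by
          rw [derivT_ode]; exact abs_sub _ _
      _ ≤ (2 * d + 1) * 1 * (C1 * n ^ (d + 1)) + ((n : ℝ) ^ 2 + d ^ 2) * (C0 * n ^ d) := by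
          rw [abs_mul, abs_mul, abs_mul, abs_of_nonneg (by positivity : (0 : ℝ) ≤ 2 * d + 1)]
          gcongr
          · exact h1' n x hx
          · exact (abs_sub _ _).trans (by simp)
          · exact h0' n x hx
      _ ≤ (2 * d + 1) * C1 * n ^ (d + 2) + (1 + d ^ 2) * C0 * n ^ (d + 2) := by
          have e1 : (n : ℝ) ^ (d + 1) ≤ n ^ (d + 2) := pow_le_pow_right₀ hn1 (by omega)
          have e2 : ((n : ℝ) ^ 2 + d ^ 2) ≤ (1 + d ^ 2) * n ^ 2 := by
            nlinarith [mul_nonneg (sq_nonneg (d : ℝ)) (by nlinarith : (0 : ℝ) ≤ (n : ℝ) ^ 2 - 1)]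
          have e3 : ((n : ℝ) ^ 2 + d ^ 2) * (C0 * n ^ d) ≤ (1 + d ^ 2) * C0 * n ^ (d + 2) := by
            calc _ ≤ ((1 + d ^ 2) * (n : ℝ) ^ 2) * (C0 * n ^ d) := by gcongr
              _ = _ := by ring
          rw [mul_one, ← mul_assoc]
          gcongr
      _ = _ := by ring

/-- `derivT_ode` writes n² T_n^(j) through the orders j, j + 1, j + 2: two orders of convergence buy
a factor n². -/
theorem summable_sq_mul_derivT {α : ℕ → ℝ} {x : ℝ} {d : ℕ}
    (h : ∀ j ≤ d + 2, Summable fun n => α n * derivT j n x) :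
    ∀ j ≤ d, Summable fun n : ℕ => (n : ℝ) ^ 2 * α n * derivT j n x := by
  intro j hj
  have := (((h (j + 1) (by omega)).mul_left ((2 * j + 1) * x)).sub
    ((h (j + 2) (by omega)).mul_left (1 - x ^ 2))).add ((h j (by omega)).mul_left ((j : ℝ) ^ 2))
  refine this.congr fun n => ?_
  linear_combination -α n * derivT_ode j n x

/-- cos(nθ) and sin(nθ) are never small together, and |T_n'(cos θ)| ≥ |sin(nθ)|. Two consecutive
orders therefore control the coefficient, at the cost of one power of n. -/
theorem one_le_abs_derivT_add {x : ℝ} (hx : |x| < 1) (n : ℕ) (hn : n ≠ 0) :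
    1 ≤ |derivT 0 n x| + |derivT 1 n x| := by
  obtain ⟨θ, rfl, hs, hs2⟩ := exists_arg hx
  have h1 := congrArg abs (derivT_one_cos n θ)
  rw [abs_mul, abs_mul, abs_of_pos hs, Nat.abs_cast] at h1
  have hn1 : (1 : ℝ) ≤ n := by exact_mod_cast Nat.one_le_iff_ne_zero.2 hn
  have h2 : |Real.sin (n * θ)| ≤ |derivT 1 n (Real.cos θ)| := by
    calc |Real.sin (n * θ)| ≤ n * |Real.sin (n * θ)| := le_mul_of_one_le_left (abs_nonneg _) hn1
      _ = _ := h1.symm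
      _ ≤ _ := mul_le_of_le_one_right (abs_nonneg _) (Real.sin_le_one θ)
  have h3 := Real.sin_sq_add_cos_sq (n * θ)
  have h4 := Real.abs_sin_le_one (n * θ)
  have h5 := Real.abs_cos_le_one (n * θ)
  rw [derivT_zero_cos]
  rw [← sq_abs (Real.sin _), ← sq_abs (Real.cos _)] at h3
  nlinarith [abs_nonneg (Real.sin (n * θ)), abs_nonneg (Real.cos (n * θ))]

theorem nat_le_of_derivT {x : ℝ} (hx : |x| < 1) (n : ℕ) :
    (n : ℝ) ≤ (n : ℝ) ^ 2 * |derivT 0 n x| + |derivT 1 n x| := by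
  rcases eq_or_ne n 0 with rfl | hn
  · simp
  obtain ⟨θ, rfl, hs, hs2⟩ := exists_arg hx
  have h1 := congrArg abs (derivT_one_cos n θ)
  rw [abs_mul, abs_mul, abs_of_pos hs, Nat.abs_cast] at h1
  have hn1 : (1 : ℝ) ≤ n := by exact_mod_cast Nat.one_le_iff_ne_zero.2 hn
  have h2 : n * |Real.sin (n * θ)| ≤ |derivT 1 n (Real.cos θ)| := by
    rw [← h1]
    exact mul_le_of_le_one_right (abs_nonneg _) (Real.sin_le_one θ)
  have h3 := Real.sin_sq_add_cos_sq (n * θ)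
  have h4 := Real.abs_sin_le_one (n * θ)
  have h5 := Real.abs_cos_le_one (n * θ)
  rw [derivT_zero_cos]
  rw [← sq_abs (Real.sin _), ← sq_abs (Real.cos _)] at h3
  have h6 : 1 ≤ |Real.sin (n * θ)| + |Real.cos (n * θ)| := by
    nlinarith [abs_nonneg (Real.sin (n * θ)), abs_nonneg (Real.cos (n * θ))]
  have h7 : (n : ℝ) * |Real.cos (n * θ)| ≤ (n : ℝ) ^ 2 * |Real.cos (n * θ)| := by
    gcongr; nlinarith
  nlinarith

/-- Absolute convergence at a point of `(-1, 1)` of the Chebyshev series and of its first `d + 1`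
derived series forces the coefficients to decay. -/
theorem summable_pow_mul_coeff {x : ℝ} (hx : |x| < 1) (d : ℕ) :
    ∀ α : ℕ → ℝ, (∀ j ≤ d + 1, Summable fun n => α n * derivT j n x) →
      Summable fun n : ℕ => (n : ℝ) ^ d * |α n| := by
  induction d using Nat.twoStepInduction with
  | zero =>
    intro α h
    have := (h 0 (by omega)).abs.add (h 1 (by omega)).abs
    refine Summable.of_norm_bounded_eventually_nat this ?_
    filter_upwards [eventually_ne_atTop 0] with n hn
    rw [pow_zero, one_mul, norm_abs_eq_norm, Real.norm_eq_abs, abs_mul, abs_mul, ← mul_add]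
    exact le_mul_of_one_le_right (abs_nonneg _) (one_le_abs_derivT_add hx n hn)
  | one =>
    intro α h
    have := (summable_sq_mul_derivT (d := 0) h 0 le_rfl).abs.add (h 1 (by omega)).abs
    refine Summable.of_norm_bounded this fun n => ?_
    rw [pow_one, norm_mul, norm_abs_eq_norm, Real.norm_natCast, Real.norm_eq_abs, abs_mul, abs_mul,
      abs_mul, abs_of_nonneg (by positivity : (0 : ℝ) ≤ (n : ℝ) ^ 2)]
    calc _ ≤ ((n : ℝ) ^ 2 * |derivT 0 n x| + |derivT 1 n x|) * |α n| := by
          gcongr; exact nat_le_of_derivT hx n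
      _ = _ := by ring
  | more d ih0 _ =>
    intro α h
    -- The induction hypothesis is applied to the coefficients n² α_n, which satisfy the convergence
    -- assumption two orders lower.
    refine (ih0 _ (summable_sq_mul_derivT (d := d + 1) h)).congr fun n => ?_
    rw [abs_mul, abs_of_nonneg (by positivity : (0 : ℝ) ≤ (n : ℝ) ^ 2)]
    ring

theorem hasSum_congr {f g : ℕ → ℝ} {a b : ℝ} (h : HasSum f a) (hfg : ∀ n, g n = f n)
    (hab : b = a) : HasSum g b := by
  rwa [hab, show g = f from funext hfg]

theorem summable_pow_mul_of_le {α : ℕ → ℝ} {p q : ℕ} (hpq : p ≤ q)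
    (h : Summable fun n : ℕ => (n : ℝ) ^ q * |α n|) :
    Summable fun n : ℕ => (n : ℝ) ^ p * |α n| := by
  refine Summable.of_norm_bounded_eventually_nat h ?_
  filter_upwards [eventually_ge_atTop 1] with n hn
  have hn1 : (1 : ℝ) ≤ n := by exact_mod_cast hn
  rw [norm_mul, norm_abs_eq_norm, Real.norm_eq_abs, Real.norm_eq_abs,
    abs_of_nonneg (by positivity)]
  gcongr

theorem summable_mul_derivT {α : ℕ → ℝ} {d : ℕ} (h : Summable fun n : ℕ => (n : ℝ) ^ d * |α n|)
    {x : ℝ} (hx : |x| < 1) : Summable fun n => α n * derivT d n x := by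
  obtain ⟨C, hC, hb⟩ := exists_abs_derivT_le (abs_nonneg x) hx d
  refine Summable.of_norm_bounded (h.mul_left C) fun n => ?_
  rw [Real.norm_eq_abs, abs_mul]
  have := mul_le_mul_of_nonneg_left (hb n x le_rfl) (abs_nonneg (α n))
  linarith

/-! ### Termwise differentiation inside (-1, 1) -/

/-- A Chebyshev series with sufficiently decaying coefficients can be differentiated termwise
inside `(-1, 1)`. -/
theorem eventually_hasSum_derivT {α : ℕ → ℝ} {F : ℕ → ℝ → ℝ} {x : ℝ} (hx : |x| < 1)
    (h0 : ∀ᶠ y in 𝓝 x, HasSum (fun n => α n * derivT 0 n y) (F 0 y)) (d : ℕ)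
    (hα : Summable fun n : ℕ => (n : ℝ) ^ d * |α n|)
    (hF : ∀ j < d, ∀ᶠ y in 𝓝 x, HasDerivAt (F j) (F (j + 1) y) y) :
    ∀ᶠ y in 𝓝 x, HasSum (fun n => α n * derivT d n y) (F d y) := by
  induction d with
  | zero => exact h0
  | succ d ih =>
    have ih' := ih (summable_pow_mul_of_le d.le_succ hα) fun j hj => hF j (by omega)
    obtain ⟨ρ, hxρ, hρ⟩ := exists_between hx
    have hρ0 : 0 ≤ ρ := (abs_nonneg x).trans hxρ.le
    obtain ⟨C, hC, hb⟩ := exists_abs_derivT_le hρ0 hρ (d + 1)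
    have hx' : x ∈ Ioo (-ρ) ρ := abs_lt.1 hxρ
    filter_upwards [ih'.eventually_nhds, hF d (by omega), isOpen_Ioo.mem_nhds hx'] with y h1 h2 h3
    have h4 := hasDerivAt_tsum_of_isPreconnected (hα.mul_left C) (isOpen_Ioo (a := -ρ) (b := ρ))
      isPreconnected_Ioo (fun n z _ => (hasDerivAt_derivT d n z).const_mul (α n))
      (fun n z hz => by
        rw [Real.norm_eq_abs, abs_mul]
        have := mul_le_mul_of_nonneg_left (hb n z (abs_lt.2 hz).le) (abs_nonneg (α n))
        linarith) h3 h1.self_of_nhds.summable h3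
    have h5 : (fun z => ∑' n, α n * derivT d n z) =ᶠ[𝓝 y] F d := by
      filter_upwards [h1] with z hz using hz.tsum_eq
    rw [h2.unique (h4.congr_of_eventuallyEq h5.symm)]
    exact (summable_mul_derivT hα ((abs_lt.2 h3).trans hρ)).hasSum

/-- The odd part of F ∘ cos about `θ` is -Σ α_n sin(nθ) sin(nt), whose derived series at t = 0 is
-sin θ · Σ α_n T_n'(cos θ). -/
theorem hasSum_derivT_one {α : ℕ → ℝ} {F : ℝ → ℝ} {F' x : ℝ} (hx : |x| < 1)
    (h0 : ∀ᶠ y in 𝓝 x, HasSum (fun n => α n * derivT 0 n y) (F y)) (hF : HasDerivAt F F' x)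
    (h1 : Summable fun n => α n * derivT 1 n x) : HasSum (fun n => α n * derivT 1 n x) F' := by
  obtain ⟨θ, rfl, hs, -⟩ := exists_arg hx
  have hterm : ∀ n : ℕ, n * (-(α n * Real.sin (n * θ))) =
      -Real.sin θ * (α n * derivT 1 n (Real.cos θ)) := fun n => by
    linear_combination α n * derivT_one_cos n θ
  have hd : HasDerivAt (fun t => F (Real.cos t)) (F' * -Real.sin θ) θ :=
    hF.comp θ (Real.hasDerivAt_cos θ)
  have hp : Tendsto (fun t => Real.cos (θ + t)) (𝓝 0) (𝓝 (Real.cos θ)) :=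
    (by fun_prop : Continuous fun t => Real.cos (θ + t)).tendsto' _ _ (by simp)
  have hm : Tendsto (fun t => Real.cos (θ - t)) (𝓝 0) (𝓝 (Real.cos θ)) :=
    (by fun_prop : Continuous fun t => Real.cos (θ - t)).tendsto' _ _ (by simp)
  have key := hasSum_of_odd_part_sine_series
    (b := fun n => -(α n * Real.sin (n * θ))) (by simp only [hterm]; exact h1.mul_left _) hd (by
      filter_upwards [hp.eventually h0, hm.eventually h0] with t ht1 ht2
      refine ((ht1.sub ht2).div_const 2).congr_fun fun n => ?_
      rw [derivT_zero_cos, derivT_zero_cos, mul_add, mul_sub, Real.cos_add, Real.cos_sub]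
      ring)
  simp only [hterm] at key
  refine (hasSum_mul_left_iff (neg_ne_zero.2 hs.ne')).1 ?_
  rwa [mul_comm (-Real.sin θ) F']

/-- The same device for F1(cos t) sin t = Σ n α_n sin(nt) sums Σ n² α_n T_n(x); the Chebyshev
equation then yields the second derived series. -/
theorem hasSum_derivT_two {α : ℕ → ℝ} {F F1 : ℝ → ℝ} {F2 x : ℝ} (hx : |x| < 1)
    (h0 : ∀ᶠ y in 𝓝 x, HasSum (fun n => α n * derivT 0 n y) (F y))
    (hF : ∀ᶠ y in 𝓝 x, HasDerivAt F (F1 y) y) (hF1 : HasDerivAt F1 F2 x)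
    (h : ∀ j ≤ 2, Summable fun n => α n * derivT j n x) :
    HasSum (fun n => α n * derivT 2 n x) F2 := by
  have h1 : ∀ᶠ y in 𝓝 x, HasSum (fun n => α n * derivT 1 n y) (F1 y) :=
    eventually_hasSum_derivT (F := fun j => if j = 0 then F else F1) hx (by simpa using h0) 1
      (summable_pow_mul_coeff hx 1 α h) (fun j hj => by
        obtain rfl : j = 0 := by omega
        simpa using hF)
  have h1x := h1.self_of_nhds
  have hsq := summable_sq_mul_derivT (d := 0) h 0 le_rfl
  obtain ⟨θ, rfl, hs, hs2⟩ := exists_arg hx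
  have hterm : ∀ n : ℕ, n * (n * α n * Real.cos (n * θ)) =
      (n : ℝ) ^ 2 * α n * derivT 0 n (Real.cos θ) := fun n => by
    rw [derivT_zero_cos]; ring
  have hd : HasDerivAt (fun t => F1 (Real.cos t) * Real.sin t)
      (F2 * -Real.sin θ * Real.sin θ + F1 (Real.cos θ) * Real.cos θ) θ :=
    HasDerivAt.mul (hF1.comp θ (Real.hasDerivAt_cos θ)) (Real.hasDerivAt_sin θ)
  have hp : Tendsto (fun t => Real.cos (θ + t)) (𝓝 0) (𝓝 (Real.cos θ)) :=
    (by fun_prop : Continuous fun t => Real.cos (θ + t)).tendsto' _ _ (by simp)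
  have hm : Tendsto (fun t => Real.cos (θ - t)) (𝓝 0) (𝓝 (Real.cos θ)) :=
    (by fun_prop : Continuous fun t => Real.cos (θ - t)).tendsto' _ _ (by simp)
  have key := hasSum_of_odd_part_sine_series
    (b := fun n => n * α n * Real.cos (n * θ)) (by simp only [hterm]; exact hsq) hd (by
      filter_upwards [hp.eventually h1, hm.eventually h1] with t ht1 ht2
      refine (((ht1.mul_right (Real.sin (θ + t))).sub
        (ht2.mul_right (Real.sin (θ - t)))).div_const 2).congr_fun fun n => ?_
      rw [mul_assoc (α n), mul_assoc (α n), derivT_one_cos, derivT_one_cos, mul_add, mul_sub,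
        Real.sin_add, Real.sin_sub]
      ring)
  simp only [hterm] at key
  have h3 := (h1x.mul_left (Real.cos θ)).sub key
  refine (hasSum_mul_left_iff (pow_ne_zero 2 hs.ne')).1 ?_
  refine hasSum_congr h3 (fun n => ?_) (by ring)
  have := derivT_ode 0 n (Real.cos θ)
  rw [hs2]
  push_cast at this
  linear_combination α n * this

/-- Termwise differentiation of an absolutely convergent Chebyshev series at a point of
`(-1, 1)`: the highest derivative is only required to exist at that point. -/
theorem hasSum_derivT_of_interior {x : ℝ} (hx : |x| < 1) (d : ℕ) :
    ∀ (α : ℕ → ℝ) (F : ℕ → ℝ → ℝ),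
      (∀ᶠ y in 𝓝 x, HasSum (fun n => α n * derivT 0 n y) (F 0 y)) →
      (∀ j ≤ d, ∀ᶠ y in 𝓝 x, HasDerivAt (F j) (F (j + 1) y) y) →
      (∀ j ≤ d + 1, Summable fun n => α n * derivT j n x) →
      HasSum (fun n => α n * derivT (d + 1) n x) (F (d + 1) x) := by
  induction d using Nat.twoStepInduction with
  | zero => exact fun α F h0 hF h =>
      hasSum_derivT_one hx h0 (hF 0 le_rfl).self_of_nhds (h 1 le_rfl)
  | one => exact fun α F h0 hF h =>
      hasSum_derivT_two hx h0 (hF 0 (by omega)) (hF 1 le_rfl).self_of_nhds h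
  | more d ih0 _ =>
    intro α F h0 hF h
    have hα := summable_pow_mul_coeff hx (d + 2) α h
    have hsum : ∀ j ≤ d + 2, ∀ᶠ y in 𝓝 x, HasSum (fun n => α n * derivT j n y) (F j y) :=
      fun j hj => eventually_hasSum_derivT hx h0 j (summable_pow_mul_of_le hj hα)
        fun i hi => hF i (by omega)
    -- The new family consists of the successive derivatives of y F' - (1 - y²) F'', the Chebyshev
    -- operator that multiplies T_n by n².
    have key := ih0 (fun n => (n : ℝ) ^ 2 * α n) (fun j y => (2 * j + 1) * y * F (j + 1) y -
        (1 - y ^ 2) * F (j + 2) y + (j : ℝ) ^ 2 * F j y) (by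
        filter_upwards [hsum 1 (by omega), hsum 2 (by omega)] with y s1 s2
        refine hasSum_congr ((s1.mul_left y).sub (s2.mul_left (1 - y ^ 2))) (fun n => ?_) (by simp)
        have := derivT_ode 0 n y
        push_cast at this
        linear_combination α n * this)
      (fun j hj => by
        filter_upwards [hF j (by omega), hF (j + 1) (by omega), hF (j + 2) (by omega)]
          with y d0 d1 d2
        have e1 := ((hasDerivAt_id y).const_mul (2 * (j : ℝ) + 1)).mul d1
        have e2 := ((hasDerivAt_const y (1 : ℝ)).sub ((hasDerivAt_id y).pow 2)).mul d2
        refine ((e1.sub e2).add (d0.const_mul ((j : ℝ) ^ 2))).congr_deriv ?_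
        simp
        ring)
      (summable_sq_mul_derivT (d := d + 1) h)
    have s1 := (hsum (d + 1) (by omega)).self_of_nhds
    have s2 := (hsum (d + 2) (by omega)).self_of_nhds
    have h3 := ((s2.mul_left ((2 * ((d + 1 : ℕ) : ℝ) + 1) * x)).add
      (s1.mul_left (((d + 1 : ℕ) : ℝ) ^ 2))).sub key
    -- Solving the equation of order d + 1 for the top derivative divides by 1 - x², which is why
    -- the end points need another argument.
    have hne : 1 - x ^ 2 ≠ 0 := by
      have := (sq_lt_one_iff_abs_lt_one x).2 hx
      linarith
    refine (hasSum_mul_left_iff hne).1 ?_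
    refine hasSum_congr h3 (fun n => ?_) (by ring)
    linear_combination α n * derivT_ode (d + 1) n x

/-! ### The end points, and the scalar theorem -/

theorem derivT_neg (d n : ℕ) : ∀ x : ℝ,
    derivT d n (-x) = (-1) ^ d * (((n : ℤ).negOnePow : ℤ) : ℝ) * derivT d n x := by
  induction d with
  | zero => intro x; simp [derivT_zero, T_eval_neg]
  | succ d ih =>
    intro x
    have h1 : HasDerivAt (fun y => derivT d n (-y)) (-derivT (d + 1) n (-x)) x :=
      ((hasDerivAt_derivT d n (-x)).comp x (hasDerivAt_neg x)).congr_deriv (by ring)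
    have h2 := (hasDerivAt_derivT d n x).const_mul ((-1) ^ d * (((n : ℤ).negOnePow : ℤ) : ℝ))
    rw [← funext ih] at h2
    have := h1.unique h2
    rw [pow_succ]
    linarith

theorem abs_derivT_eq {x : ℝ} (hx : |x| = 1) (d n : ℕ) : |derivT d n x| = derivT d n 1 := by
  have h1 : |derivT d n 1| = derivT d n 1 :=
    abs_of_nonneg ((abs_nonneg _).trans (abs_iterate_derivative_T_real_le (x := 1) n d (by simp)))
  rcases (abs_eq zero_le_one).1 hx with rfl | rfl
  · exact h1
  · rw [derivT_neg, abs_mul, abs_mul, abs_pow, abs_neg, abs_one, one_pow, one_mul, h1]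
    rcases Int.units_eq_one_or (n : ℤ).negOnePow with h | h <;> simp [h]

/-- Termwise differentiation of an absolutely convergent Chebyshev series at `±1`. -/
theorem hasSum_derivT_of_endpoint {α : ℕ → ℝ} {F : ℕ → ℝ → ℝ} {x : ℝ} (hx : |x| = 1) {V : Set ℝ}
    (hV : IsOpen V)
    (h0 : ∀ y ∈ Icc (-1 : ℝ) 1 ∩ V, HasSum (fun n => α n * derivT 0 n y) (F 0 y)) (d : ℕ)
    (hF : ∀ j < d, ∀ y ∈ Icc (-1 : ℝ) 1 ∩ V,
      HasDerivWithinAt (F j) (F (j + 1) y) (Icc (-1) 1) y)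
    (h : ∀ j ≤ d, Summable fun n => α n * derivT j n x) :
    ∀ y ∈ Icc (-1 : ℝ) 1 ∩ V, HasSum (fun n => α n * derivT d n y) (F d y) := by
  -- T_n^(j)(1) dominates |T_n^(j)| on [-1, 1], so convergence at `x` = ±1 supplies a uniform
  -- majorant.
  have hb : ∀ j ≤ d, Summable fun n => |α n| * derivT j n 1 := fun j hj => by
    simpa [abs_mul, abs_derivT_eq hx] using (h j hj).abs
  have hle : ∀ j n, ∀ y ∈ Icc (-1 : ℝ) 1, |α n * derivT j n y| ≤ |α n| * derivT j n 1 :=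
    fun j n y hy => by
      rw [abs_mul]
      exact mul_le_mul_of_nonneg_left (abs_iterate_derivative_T_real_le n j (abs_le.2 hy))
        (abs_nonneg _)
  have hs : ∀ j ≤ d, ∀ y ∈ Icc (-1 : ℝ) 1, Summable fun n => α n * derivT j n y :=
    fun j hj y hy => Summable.of_norm_bounded (hb j hj) fun n => hle j n y hy
  induction d with
  | zero => exact h0
  | succ d ih =>
    intro y hy
    have ih' := ih (fun j hj => hF j (by omega)) (fun j hj => h j (by omega))
      (fun j hj => hb j (by omega)) (fun j hj => hs j (by omega))
    have h1 := hasDerivWithinAt_tsum_of_convex (convex_Icc (-1 : ℝ) 1) (hb (d + 1) le_rfl)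
      (fun n z _ => ((hasDerivAt_derivT d n z).const_mul (α n)).hasDerivWithinAt)
      (hle (d + 1)) (hs d (by omega)) hy.1
    have h2 : F d =ᶠ[𝓝[Icc (-1) 1] y] fun z => ∑' n, α n * derivT d n z := by
      filter_upwards [self_mem_nhdsWithin, mem_nhdsWithin_of_mem_nhds (hV.mem_nhds hy.2)]
        with z hz hzV using (ih' z ⟨hz, hzV⟩).tsum_eq.symm
    have h3 := h1.congr_of_eventuallyEq h2 (ih' y hy).tsum_eq.symm
    rw [(uniqueDiffOn_Icc (by norm_num) y hy.1).eq_deriv _ (hF d (by omega) y hy) h3]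
    exact (hs (d + 1) le_rfl y hy.1).hasSum

/-- If `f` is `d` times differentiable near `x` and the Chebyshev series of `f` and its first `d`
derived series converge absolutely at `x`, then the `d`-th derived series sums to the `d`-th
derivative of `f`. -/
theorem hasSum_halvedCoeff_mul_derivT {f : ℝ → ℝ} (hf : ContinuousOn f (Icc (-1) 1))
    {F : ℕ → ℝ → ℝ} {V : Set ℝ} (hV : IsOpen V) {x : ℝ} (hx : x ∈ Icc (-1 : ℝ) 1) (hxV : x ∈ V)
    (hF0 : F 0 = f) (d : ℕ)
    (hF : ∀ j < d, ∀ y ∈ Icc (-1 : ℝ) 1 ∩ V,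
      HasDerivWithinAt (F j) (F (j + 1) y) (Icc (-1) 1) y)
    (h : ∀ j ≤ d, Summable fun n => halvedCoeff f n * derivT j n x) :
    HasSum (fun n => halvedCoeff f n * derivT d n x) (F d x) := by
  subst hF0
  rcases (abs_le.2 hx).lt_or_eq with hlt | heq
  · cases d with
    -- Only here may the coefficients fail to be summable; one further order of convergence already
    -- forces summability.
    | zero => exact hasSum_chebyshev_of_summable_term hf hx (h 0 le_rfl)
    | succ d =>
      have hc : Summable (halvedCoeff (F 0)) := by
        have := summable_pow_mul_coeff hlt 0 _ fun j hj => h j (by omega)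
        exact summable_abs_iff.1 (by simpa using this)
      have hmem : Ioo (-1 : ℝ) 1 ∈ 𝓝 x := isOpen_Ioo.mem_nhds (abs_lt.1 hlt)
      refine hasSum_derivT_of_interior hlt d _ F ?_ (fun j hj => ?_) h
      · filter_upwards [hmem] with y hy
        exact hasSum_chebyshev_of_summable_coeff hf hc (Ioo_subset_Icc_self hy)
      · filter_upwards [hmem, hV.mem_nhds hxV] with y hy hyV
        exact (hF j (by omega) y ⟨Ioo_subset_Icc_self hy, hyV⟩).hasDerivAt
          (Icc_mem_nhds hy.1 hy.2)
  · refine hasSum_derivT_of_endpoint heq hV (fun y hy => ?_) d hF h x ⟨hx, hxV⟩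
    refine hasSum_chebyshev_of_summable_coeff hf ?_ hy.1
    have := (h 0 (by omega)).abs
    simp only [abs_mul, abs_derivT_eq heq] at this
    exact summable_abs_iff.1 (by simpa [derivT_zero] using this)

open Matrix

/-! ### The matrix series on generalized eigenvectors -/

/-- A linear functional on a finite-dimensional space is bounded for any norm. -/
theorem exists_abs_le_mul_seminorm {V : Type*} [AddCommGroup V] [Module ℝ V]
    [FiniteDimensional ℝ V] (ν : Seminorm ℝ V) (hν : ∀ x, ν x = 0 → x = 0) (L : V →ₗ[ℝ] ℝ) :
    ∃ C, ∀ x, |L x| ≤ C * ν x := by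
  let G : AddGroupNorm V :=
    { ν.toAddGroupSeminorm with eq_zero_of_map_eq_zero' := hν }
  let _ : NormedAddCommGroup V := G.toNormedAddCommGroup
  let _ : NormedSpace ℝ V := ⟨fun a x => (map_smul_eq_mul ν a x).le⟩
  exact ⟨‖LinearMap.toContinuousLinearMap L‖,
    fun x => (LinearMap.toContinuousLinearMap L).le_opNorm x⟩

theorem summable_linearMap_of_summable_norm {k : ℕ} (ν : AlgebraNorm ℝ (Matrix (Fin k) (Fin k) ℝ))
    {M : ℕ → Matrix (Fin k) (Fin k) ℝ} (hM : Summable fun n => ν (M n))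
    (L : Matrix (Fin k) (Fin k) ℝ →ₗ[ℝ] ℝ) : Summable fun n => L (M n) := by
  obtain ⟨C, hC⟩ := exists_abs_le_mul_seminorm ν.toSeminorm
    (fun x hx => ν.eq_zero_of_map_eq_zero' x hx) L
  exact Summable.of_norm_bounded (hM.mul_left C) fun n => hC (M n)

theorem eval_taylor_coeff (p : ℝ[X]) (μ : ℝ) (d : ℕ) :
    (taylor μ p).coeff d = (derivative^[d] p).eval μ / (d ! : ℝ) := by
  rw [taylor_coeff, ← factorial_smul_hasseDeriv]
  have : (d ! : ℝ) ≠ 0 := by positivity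
  rw [LinearMap.smul_apply, eval_smul, nsmul_eq_mul]
  field_simp

/-- The action of `p(A)` on a generalized eigenvector. -/
theorem aeval_mulVec_of_pow_mulVec_eq_zero {k : ℕ} {A : Matrix (Fin k) (Fin k) ℝ} {μ : ℝ} {l : ℕ}
    {v : Fin k → ℝ} (hv : (A - μ • 1) ^ l *ᵥ v = 0) (p : ℝ[X]) :
    aeval A p *ᵥ v = ∑ d ∈ Finset.range l,
      ((derivative^[d] p).eval μ / (d ! : ℝ)) • ((A - μ • 1) ^ d *ᵥ v) := by
  have h1 : aeval A p = aeval (A - μ • 1) (taylor μ p) := by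
    have : aeval A (X - C μ) = A - μ • 1 := by simp [Algebra.algebraMap_eq_smul_one]
    rw [← this, ← aeval_comp, taylor_apply, comp_assoc]
    simp
  -- The Taylor sum is padded to length at least `l`; the terms of index ≥ `l` annihilate `v`.
  rw [h1, aeval_eq_sum_range' (n := max l ((taylor μ p).natDegree + 1)) (by omega), sum_mulVec]
  simp only [eval_taylor_coeff, smul_mulVec]
  refine (Finset.sum_subset (Finset.range_mono (le_max_left _ _)) fun d _ hd => ?_).symm
  obtain ⟨e, rfl⟩ := Nat.exists_eq_add_of_le (not_lt.1 fun h => hd (Finset.mem_range.2 h))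
  rw [add_comm, pow_add, ← mulVec_mulVec, hv, mulVec_zero, smul_zero]

theorem term_mulVec {k : ℕ} {A : Matrix (Fin k) (Fin k) ℝ} {μ : ℝ} {l : ℕ}
    {v : Fin k → ℝ} (hv : (A - μ • 1) ^ l *ᵥ v = 0) (f : ℝ → ℝ) (n : ℕ) :
    term f A n *ᵥ v = ∑ d ∈ Finset.range l,
      (halvedCoeff f n * derivT d n μ / (d ! : ℝ)) • ((A - μ • 1) ^ d *ᵥ v) := by
  rw [term_eq_smul, smul_mulVec, aeval_mulVec_of_pow_mulVec_eq_zero hv, Finset.smul_sum]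
  simp only [smul_smul, derivT, mul_div_assoc]

/-- Absolute convergence of the matrix series forces absolute convergence of the derived scalar
series at an eigenvalue, up to the order given by the length of a chain of generalized
eigenvectors. -/
theorem summable_halvedCoeff_mul_derivT {k : ℕ} {A : Matrix (Fin k) (Fin k) ℝ} {f : ℝ → ℝ}
    (ν : AlgebraNorm ℝ (Matrix (Fin k) (Fin k) ℝ)) (habs : Summable fun n => ν (term f A n))
    {μ : ℝ} {l : ℕ} {v : Fin k → ℝ} (hv : (A - μ • 1) ^ (l + 1) *ᵥ v = 0)
    (hv' : (A - μ • 1) ^ l *ᵥ v ≠ 0) :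
    ∀ d ≤ l, Summable fun n => halvedCoeff f n * derivT d n μ := by
  intro d
  induction d using Nat.strong_induction_on with
  | _ d ih =>
    intro hd
    obtain ⟨i, hi⟩ := Function.ne_iff.1 hv'
    set N := A - μ • (1 : Matrix (Fin k) (Fin k) ℝ)
    -- N^(l-d) v is killed by N^(d+1), so only orders up to d appear on it. The top one has the
    -- coordinate (N^l v)_i / d! ≠ 0, and the lower ones are summable by induction.
    have hw : N ^ (d + 1) *ᵥ (N ^ (l - d) *ᵥ v) = 0 := by
      rw [mulVec_mulVec, ← pow_add, show d + 1 + (l - d) = l + 1 by omega, hv]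
    let L : Matrix (Fin k) (Fin k) ℝ →ₗ[ℝ] ℝ :=
      { toFun := fun M => (M *ᵥ (N ^ (l - d) *ᵥ v)) i
        map_add' := fun M M' => by rw [add_mulVec]; rfl
        map_smul' := fun a M => by rw [smul_mulVec]; rfl }
    have hs := summable_linearMap_of_summable_norm ν habs L
    have hL : ∀ n, L (term f A n) = (∑ e ∈ Finset.range d,
        halvedCoeff f n * derivT e n μ / (e ! : ℝ) * (N ^ e *ᵥ (N ^ (l - d) *ᵥ v)) i) +
        halvedCoeff f n * derivT d n μ * ((N ^ l *ᵥ v) i / (d ! : ℝ)) := by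
      intro n
      change (term f A n *ᵥ (N ^ (l - d) *ᵥ v)) i = _
      rw [term_mulVec hw, Finset.sum_range_succ, Pi.add_apply, Finset.sum_apply, mulVec_mulVec,
        ← pow_add, Nat.add_sub_cancel' hd]
      simp only [Pi.smul_apply, smul_eq_mul]
      ring
    have hs2 : Summable fun n => ∑ e ∈ Finset.range d,
        halvedCoeff f n * derivT e n μ / (e ! : ℝ) * (N ^ e *ᵥ (N ^ (l - d) *ᵥ v)) i := by
      refine summable_sum fun e he => ?_
      have hed := Finset.mem_range.1 he
      exact ((ih e hed (by omega)).div_const _).mul_right _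
    have h3 : Summable fun n => halvedCoeff f n * derivT d n μ * ((N ^ l *ᵥ v) i / (d ! : ℝ)) :=
      (hs.sub hs2).congr fun n => by rw [hL]; ring
    have hne : (N ^ l *ᵥ v) i / (d ! : ℝ) ≠ 0 := div_ne_zero hi (by positivity)
    exact (summable_mul_right_iff hne).1 h3

/-- The limit of the matrix Chebyshev series on a generalized eigenvector. -/
theorem tendsto_partialSum_mulVec {k : ℕ} {A : Matrix (Fin k) (Fin k) ℝ} {f : ℝ → ℝ}
    (hf : ContinuousOn f (Icc (-1) 1))
    (ν : AlgebraNorm ℝ (Matrix (Fin k) (Fin k) ℝ)) (habs : Summable fun n => ν (term f A n))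
    {μ : ℝ} (hμ : μ ∈ Icc (-1 : ℝ) 1) {l : ℕ} {v : Fin k → ℝ}
    (hv : (A - μ • 1) ^ (l + 1) *ᵥ v = 0) (hv' : (A - μ • 1) ^ l *ᵥ v ≠ 0)
    {F : ℕ → ℝ → ℝ} {V : Set ℝ} (hV : IsOpen V) (hμV : μ ∈ V) (hF0 : F 0 = f)
    (hF : ∀ j < l, ∀ y ∈ Icc (-1 : ℝ) 1 ∩ V,
      HasDerivWithinAt (F j) (F (j + 1) y) (Icc (-1) 1) y) :
    Tendsto (fun N => partialSum f A N *ᵥ v) atTop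
      (𝓝 (∑ d ∈ Finset.range (l + 1), (F d μ / (d ! : ℝ)) • ((A - μ • 1) ^ d *ᵥ v))) := by
  have hs := summable_halvedCoeff_mul_derivT ν habs hv hv'
  have h1 : HasSum (fun n => term f A n *ᵥ v)
      (∑ d ∈ Finset.range (l + 1), (F d μ / (d ! : ℝ)) • ((A - μ • 1) ^ d *ᵥ v)) := by
    simp only [term_mulVec hv]
    refine hasSum_sum fun d hd => HasSum.smul_const (HasSum.div_const ?_ _) _
    have hd' := Finset.mem_range.1 hd
    exact hasSum_halvedCoeff_mul_derivT hf hV hμ hμV hF0 d (fun j hj => hF j (by omega))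
      fun j hj => hs j (by omega)
  simp only [partialSum, sum_mulVec]
  exact h1.tendsto_sum_nat.comp (tendsto_add_atTop_nat 1)

theorem mem_spectrum_of_mulVec_eq {k : ℕ} {A : Matrix (Fin k) (Fin k) ℝ} {μ : ℝ} {w : Fin k → ℝ}
    (hw : w ≠ 0) (h : (A - μ • 1) *ᵥ w = 0) : μ ∈ spectrum ℝ A := by
  rw [spectrum.mem_iff, Algebra.algebraMap_eq_smul_one]
  intro hu
  refine hw (Matrix.mulVec_injective_of_isUnit hu ?_)
  rw [mulVec_zero, ← neg_sub, neg_mulVec, h, neg_zero]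

theorem mem_spectrum_of_pow_mulVec {k : ℕ} {A : Matrix (Fin k) (Fin k) ℝ} {μ : ℝ} {l : ℕ}
    {v : Fin k → ℝ} (hv : (A - μ • 1) ^ (l + 1) *ᵥ v = 0) (hv' : (A - μ • 1) ^ l *ᵥ v ≠ 0) :
    μ ∈ spectrum ℝ A :=
  mem_spectrum_of_mulVec_eq hv' (by rw [mulVec_mulVec, ← pow_succ', hv])

theorem nnnorm_le_spectralRadius_of_mem {k : ℕ} {A : Matrix (Fin k) (Fin k) ℝ} {μ : ℝ}
    (h : μ ∈ spectrum ℝ A) : (‖μ‖₊ : ℝ≥0∞) ≤ spectralRadius ℝ A :=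
  le_iSup₂ (f := fun (a : ℝ) (_ : a ∈ spectrum ℝ A) => (‖a‖₊ : ℝ≥0∞)) μ h

theorem mem_Icc_of_mem_spectrum {k : ℕ} {A : Matrix (Fin k) (Fin k) ℝ}
    (hρ : spectralRadius ℝ A ≤ 1) {μ : ℝ} (h : μ ∈ spectrum ℝ A) : μ ∈ Icc (-1 : ℝ) 1 := by
  have h1 : ‖μ‖₊ ≤ 1 := by exact_mod_cast (nnnorm_le_spectralRadius_of_mem h).trans hρ
  have h2 : ‖μ‖ ≤ 1 := h1
  exact abs_le.1 h2

/-- The generalized eigenvectors of a matrix with split characteristic polynomial span. -/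
theorem span_generalized_eigenvectors_eq_top {k : ℕ} {A : Matrix (Fin k) (Fin k) ℝ}
    (hA : A.charpoly.Splits) :
    Submodule.span ℝ {v : Fin k → ℝ | ∃ (μ : ℝ) (l : ℕ), (A - μ • 1) ^ (l + 1) *ᵥ v = 0 ∧
      (A - μ • 1) ^ l *ᵥ v ≠ 0} = ⊤ := by
  set W := Submodule.span ℝ {v : Fin k → ℝ | ∃ (μ : ℝ) (l : ℕ), (A - μ • 1) ^ (l + 1) *ᵥ v = 0 ∧
      (A - μ • 1) ^ l *ᵥ v ≠ 0}
  have hlin : ∀ (p : ℝ[X]) (v : Fin k → ℝ), aeval (toLin' A) p v = aeval A p *ᵥ v := by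
    intro p v
    have := aeval_algHom_apply (toLinAlgEquiv' (R := ℝ) (n := Fin k)).toAlgHom A p
    exact congrArg (fun L : (Fin k → ℝ) →ₗ[ℝ] (Fin k → ℝ) => L v) this
  have hmem : ∀ (a : ℝ) (m : ℕ) (v : Fin k → ℝ), (A - a • 1) ^ m *ᵥ v = 0 → v ∈ W := by
    intro a m v hm
    induction m with
    | zero =>
      obtain rfl : v = 0 := by simpa using hm
      exact W.zero_mem
    | succ m ih =>
      by_cases h : (A - a • 1) ^ m *ᵥ v = 0
      · exact ih h
      · exact Submodule.subset_span ⟨a, m, hm, h⟩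
  have hker : ∀ (m : ℝ → ℕ) (T : Finset ℝ),
      LinearMap.ker (aeval (toLin' A) (∏ a ∈ T, (X - C a) ^ m a)) ≤ W := by
    intro m T
    induction T using Finset.induction_on with
    | empty =>
      intro v hv
      obtain rfl : v = 0 := by simpa using hv
      exact W.zero_mem
    | insert a T ha ih =>
      rw [Finset.prod_insert ha, ← sup_ker_aeval_eq_ker_aeval_mul_of_coprime]
      · refine sup_le (fun v hv => hmem a (m a) v ?_) ih
        rw [LinearMap.mem_ker, hlin] at hv
        simpa [Algebra.algebraMap_eq_smul_one] using hv
      · refine IsCoprime.prod_right fun b hb => IsCoprime.pow (isCoprime_X_sub_C_of_isUnit_sub ?_)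
        exact (sub_ne_zero.2 fun h : a = b => ha (h.symm ▸ hb)).isUnit
  rw [eq_top_iff]
  intro v _
  -- With root multiplicities as exponents the product is the characteristic polynomial, whose
  -- kernel is everything by Cayley–Hamilton.
  refine hker (fun a => A.charpoly.roots.count a) A.charpoly.roots.toFinset ?_
  rw [← Finset.prod_multiset_map_count, ← hA.eq_prod_roots_of_monic A.charpoly_monic,
    LinearMap.mem_ker, hlin, aeval_self_charpoly, zero_mulVec]

/-- Matrices converge if their products with a spanning family of vectors do. -/
theorem tendsto_matrix_of_mulVec {k : ℕ} {ι : Type*} {u : Filter ι}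
    {M : ι → Matrix (Fin k) (Fin k) ℝ} {B : Matrix (Fin k) (Fin k) ℝ} {S : Set (Fin k → ℝ)}
    (hS : Submodule.span ℝ S = ⊤)
    (h : ∀ v ∈ S, Tendsto (fun i => M i *ᵥ v) u (𝓝 (B *ᵥ v))) : Tendsto M u (𝓝 B) := by
  have hall : ∀ v, Tendsto (fun i => M i *ᵥ v) u (𝓝 (B *ᵥ v)) := by
    intro v
    have hv : v ∈ Submodule.span ℝ S := hS ▸ Submodule.mem_top
    induction hv using Submodule.span_induction with
    | mem v hv => exact h v hv
    | zero => simpa only [mulVec_zero] using tendsto_const_nhds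
    | add v w _ _ hv hw => simpa only [mulVec_add] using hv.add hw
    | smul a v _ hv => simpa only [mulVec_smul] using hv.const_smul a
  refine tendsto_pi_nhds.2 fun i => tendsto_pi_nhds.2 fun j => ?_
  have := tendsto_pi_nhds.1 (hall (Pi.single j 1)) i
  simpa using this

/-! ### Jordan chains and the first definition of f(A) -/

theorem JordanForm.conj_mulVec_col {k : ℕ} {A : Matrix (Fin k) (Fin k) ℝ} (D : JordanForm A)
    (M : ∀ i, Matrix (Fin (D.size i)) (Fin (D.size i)) ℝ) (i : Fin D.numBlocks)
    (q : Fin (D.size i)) :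
    (D.Zinv * blockDiagonal' M * D.Z) *ᵥ D.Zinv.col ⟨i, q⟩ =
      ∑ p, M i p q • D.Zinv.col ⟨i, p⟩ := by
  have h1 : D.Zinv.col ⟨i, q⟩ = D.Zinv *ᵥ Pi.single ⟨i, q⟩ 1 := (mulVec_single_one _ _).symm
  rw [h1, mulVec_mulVec, Matrix.mul_assoc, D.Z_mul_Zinv, Matrix.mul_one, mulVec_single_one]
  ext a
  simp only [col_apply, mul_apply, Finset.sum_apply, Pi.smul_apply, smul_eq_mul]
  rw [Fintype.sum_sigma]
  rw [Finset.sum_eq_single i]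
  · refine Finset.sum_congr rfl fun p _ => ?_
    rw [blockDiagonal'_apply_eq, mul_comm]
  · intro j _ hj
    refine Finset.sum_eq_zero fun p _ => ?_
    rw [blockDiagonal'_apply_ne _ _ _ hj, mul_zero]
  · simp

/-- The `q`-th column of a block of the transition matrix, extended by zero. -/
noncomputable def JordanForm.chain {k : ℕ} {A : Matrix (Fin k) (Fin k) ℝ} (D : JordanForm A)
    (i : Fin D.numBlocks) (q : ℕ) : Fin k → ℝ :=
  if h : q < D.size i then D.Zinv.col ⟨i, ⟨q, h⟩⟩ else 0

theorem JordanForm.chain_of_fin {k : ℕ} {A : Matrix (Fin k) (Fin k) ℝ} (D : JordanForm A)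
    (i : Fin D.numBlocks) (p : Fin (D.size i)) : D.Zinv.col ⟨i, p⟩ = D.chain i p := by
  simp [chain]

theorem JordanForm.sub_mulVec_chain {k : ℕ} {A : Matrix (Fin k) (Fin k) ℝ} (D : JordanForm A)
    (i : Fin D.numBlocks) (q : ℕ) (hq : q < D.size i) :
    (A - D.eigenvalue i • 1) *ᵥ D.chain i q = if q = 0 then 0 else D.chain i (q - 1) := by
  have h := D.conj_mulVec_col (fun i => jordanBlock (D.size i) (D.eigenvalue i)) i ⟨q, hq⟩
  rw [← D.eq_conj] at h
  simp only [D.chain_of_fin] at h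
  have h2 : ∀ p : Fin (D.size i), jordanBlock (D.size i) (D.eigenvalue i) p ⟨q, hq⟩ •
      D.chain i p = (if (p : ℕ) = q then D.eigenvalue i • D.chain i p else 0) +
        if (p : ℕ) + 1 = q then D.chain i p else 0 := by
    intro p
    simp only [jordanBlock, of_apply, Fin.ext_iff]
    split_ifs with h3 h4 <;> first | omega | simp
  rw [sub_mulVec, smul_mulVec, one_mulVec, h]
  simp only [h2]
  rw [Finset.sum_add_distrib,
    Fin.sum_univ_eq_sum_range (fun p => if p = q then D.eigenvalue i • D.chain i p else 0),
    Fin.sum_univ_eq_sum_range (fun p => if p + 1 = q then D.chain i p else 0),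
    Finset.sum_ite_eq' _ q, if_pos (Finset.mem_range.2 hq), add_sub_cancel_left]
  rcases q with - | q
  · simp
  · simp only [Nat.add_right_cancel_iff]
    rw [Finset.sum_ite_eq', if_pos (Finset.mem_range.2 (by omega))]
    simp

/-- The columns of `Zinv` in one block form a chain: A - λ shifts the index down by one, so column q
is a generalized eigenvector of exact order q + 1. -/
theorem JordanForm.pow_mulVec_chain {k : ℕ} {A : Matrix (Fin k) (Fin k) ℝ} (D : JordanForm A)
    (i : Fin D.numBlocks) (q : ℕ) (hq : q < D.size i) (d : ℕ) :
    (A - D.eigenvalue i • 1) ^ d *ᵥ D.chain i q = if d ≤ q then D.chain i (q - d) else 0 := by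
  induction d with
  | zero => simp
  | succ d ih =>
    rw [pow_succ', ← mulVec_mulVec, ih]
    split_ifs with h1 h2 h2
    · rw [D.sub_mulVec_chain i _ (by omega), if_neg (by omega), Nat.sub_sub]
    · rw [D.sub_mulVec_chain i _ (by omega), if_pos (by omega)]
    · omega
    · rw [mulVec_zero]

theorem JordanForm.col_ne_zero {k : ℕ} {A : Matrix (Fin k) (Fin k) ℝ} (D : JordanForm A)
    (x : (i : Fin D.numBlocks) × Fin (D.size i)) : D.Zinv.col x ≠ 0 := by
  intro h
  have h1 : (D.Z * D.Zinv) x x = 0 := by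
    rw [mul_apply]
    exact Finset.sum_eq_zero fun a _ => by
      rw [show D.Zinv a x = 0 from congrFun h a, mul_zero]
  rw [D.Z_mul_Zinv, one_apply_eq] at h1
  exact one_ne_zero h1

theorem JordanForm.span_cols_eq_top {k : ℕ} {A : Matrix (Fin k) (Fin k) ℝ} (D : JordanForm A) :
    Submodule.span ℝ (range fun x => D.Zinv.col x) = ⊤ := by
  rw [eq_top_iff]
  intro v _
  have h : v = D.Zinv *ᵥ (D.Z *ᵥ v) := by rw [mulVec_mulVec, D.Zinv_mul_Z, one_mulVec]
  rw [h, mulVec_eq_sum]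
  refine Submodule.sum_mem _ fun x _ => ?_
  rw [op_smul_eq_smul]
  exact Submodule.smul_mem _ _ (Submodule.subset_span (mem_range_self x))

theorem JordanForm.apply_mulVec_chain {k : ℕ} {A : Matrix (Fin k) (Fin k) ℝ} (D : JordanForm A)
    (f : ℝ → ℝ) (i : Fin D.numBlocks) (q : ℕ) (hq : q < D.size i) :
    D.apply f *ᵥ D.chain i q = ∑ d ∈ Finset.range (q + 1),
      (iteratedDerivWithin d f (Icc (-1) 1) (D.eigenvalue i) / (d ! : ℝ)) •
        ((A - D.eigenvalue i • 1) ^ d *ᵥ D.chain i q) := by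
  have h := D.conj_mulVec_col
    (fun i => functionOnJordanBlock f (D.size i) (D.eigenvalue i)) i ⟨q, hq⟩
  simp only [D.chain_of_fin] at h
  set g : ℕ → ℝ := fun d => iteratedDerivWithin d f (Icc (-1) 1) (D.eigenvalue i) / (d ! : ℝ)
  have h2 : ∀ p : Fin (D.size i), functionOnJordanBlock f (D.size i) (D.eigenvalue i) p ⟨q, hq⟩ •
      D.chain i p = if (p : ℕ) ≤ q then g (q - p) • D.chain i p else 0 := by
    intro p
    simp only [functionOnJordanBlock, of_apply, Fin.le_def, g]
    split_ifs <;> simp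
  simp only [h2] at h
  rw [JordanForm.apply, h, Fin.sum_univ_eq_sum_range
    (fun p => if p ≤ q then g (q - p) • D.chain i p else 0), ← Finset.sum_flip]
  symm
  refine Finset.sum_congr_of_eq_on_inter ?_ ?_ ?_
  · intro p hp hp'
    simp only [Finset.mem_range] at hp hp'
    omega
  · intro p hp hp'
    simp only [Finset.mem_range] at hp hp'
    rw [if_neg (by omega)]
  · intro p hp hp'
    simp only [Finset.mem_range] at hp hp'
    rw [D.pow_mulVec_chain i q hq, if_pos (by omega), if_pos (by omega)]
    congr 2
    omega

theorem tendsto_partialSum_jordanForm {k : ℕ} {A : Matrix (Fin k) (Fin k) ℝ}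
    (hρ : spectralRadius ℝ A ≤ 1) {f : ℝ → ℝ} (hf : ContinuousOn f (Icc (-1) 1))
    (ν : AlgebraNorm ℝ (Matrix (Fin k) (Fin k) ℝ)) (habs : Summable fun n => ν (term f A n))
    (D : JordanForm A) (hd : HasDerivatives f (D.maxSize - 1)) :
    Tendsto (partialSum f A) atTop (𝓝 (D.apply f)) := by
  refine tendsto_matrix_of_mulVec D.span_cols_eq_top ?_
  rintro _ ⟨⟨i, q⟩, rfl⟩
  have hne : D.chain i 0 ≠ 0 := by
    rw [← D.chain_of_fin i ⟨0, D.size_pos i⟩]; exact D.col_ne_zero _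
  simp only [D.chain_of_fin]
  have hv : (A - D.eigenvalue i • 1) ^ ((q : ℕ) + 1) *ᵥ D.chain i q = 0 := by
    rw [D.pow_mulVec_chain i q q.2, if_neg (by omega)]
  have hv' : (A - D.eigenvalue i • 1) ^ (q : ℕ) *ᵥ D.chain i q ≠ 0 := by
    rwa [D.pow_mulVec_chain i q q.2, if_pos le_rfl, Nat.sub_self]
  have hsize : D.size i ≤ D.maxSize := Finset.le_sup (f := D.size) (Finset.mem_univ i)
  rw [D.apply_mulVec_chain f i q q.2]
  refine tendsto_partialSum_mulVec hf ν habs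
    (mem_Icc_of_mem_spectrum hρ (mem_spectrum_of_pow_mulVec hv hv')) hv hv' isOpen_univ
    (mem_univ _) (F := fun j => iteratedDerivWithin j f (Icc (-1) 1)) iteratedDerivWithin_zero
    fun j hj y hy => ?_
  -- Here j < q ≤ size - 1 ≤ `maxSize` - 1, so m - 1 derivatives suffice.
  have := (hd j (by have := q.2; omega) y hy.1).hasDerivWithinAt
  rwa [← iteratedDerivWithin_succ] at this

/-! ### Power series and the second definition of f(A) -/

/-- A convexity bound (b^m lies above its tangent at a): enlarging the radius from a to b absorbs
the factor m produced by a derivative. -/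
theorem nat_mul_pow_mul_sub_le {a b : ℝ} (ha : 0 ≤ a) (hab : a ≤ b) (m : ℕ) :
    m * a ^ (m - 1) * (b - a) ≤ b ^ m := by
  have h : m * a ^ (m - 1) * (b - a) ≤ b ^ m - a ^ m := by
    induction m with
    | zero => simp
    | succ m ih =>
      have hb : 0 ≤ b := ha.trans hab
      have h1 : (m : ℝ) * a ^ m * (b - a) ≤ a * (b ^ m - a ^ m) := by
        rcases m with - | m
        · simp
        · have := mul_le_mul_of_nonneg_left ih ha
          simp only [Nat.add_sub_cancel] at this
          calc _ = a * (((m + 1 : ℕ) : ℝ) * a ^ m * (b - a)) := by ring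
            _ ≤ _ := this
      have h2 : a * (b ^ m - a ^ m) ≤ b * (b ^ m - a ^ m) :=
        mul_le_mul_of_nonneg_right hab (sub_nonneg.2 (pow_le_pow_left₀ ha hab m))
      have h3 : 0 ≤ (b - a) * (b ^ m - a ^ m) := by nlinarith
      rw [Nat.add_sub_cancel, Nat.cast_add_one, pow_succ, pow_succ]
      nlinarith
  linarith [pow_nonneg ha m]

/-- The value at `x` of the `d`-th derivative of `X ^ n`. -/
noncomputable def derivPow (d n : ℕ) (x : ℝ) : ℝ :=
  (derivative^[d] (X ^ n : ℝ[X])).eval x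

theorem derivPow_eq (d n : ℕ) (x : ℝ) : derivPow d n x = n.descFactorial d * x ^ (n - d) := by
  simp [derivPow, iterate_derivative_X_pow_eq_natCast_mul]

theorem hasDerivAt_derivPow (d n : ℕ) (x : ℝ) :
    HasDerivAt (derivPow d n) (derivPow (d + 1) n x) x := by
  have := (derivative^[d] (X ^ n : ℝ[X])).hasDerivAt x
  rwa [← Function.iterate_succ_apply' derivative d] at this

theorem abs_derivPow_le (d n : ℕ) {x a : ℝ} (h : |x| ≤ a) : |derivPow d n x| ≤ derivPow d n a := by
  rw [derivPow_eq, derivPow_eq, abs_mul, Nat.abs_cast, abs_pow]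
  gcongr

theorem derivPow_succ_mul_sub_le (d n : ℕ) {a b : ℝ} (ha : 0 ≤ a) (hab : a ≤ b) :
    derivPow (d + 1) n a * (b - a) ≤ derivPow d n b := by
  rw [derivPow_eq, derivPow_eq, Nat.descFactorial_succ, Nat.cast_mul, ← Nat.sub_sub]
  have := mul_le_mul_of_nonneg_left (nat_mul_pow_mul_sub_le ha hab (n - d))
    (Nat.cast_nonneg (α := ℝ) (n.descFactorial d))
  calc _ = (n.descFactorial d : ℝ) * (((n - d : ℕ) : ℝ) * a ^ (n - d - 1) * (b - a)) := by ring
    _ ≤ _ := this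

section PowerSeries

variable {f : ℝ → ℝ} {p : FormalMultilinearSeries ℝ ℝ ℝ} {r : ℝ≥0∞}

theorem hasDerivAt_iteratedDeriv_of_powerSeries (hp : HasFPowerSeriesOnBall f p 0 r) (d : ℕ)
    {x : ℝ} (hx : (‖x‖₊ : ℝ≥0∞) < r) :
    HasDerivAt (iteratedDeriv d f) (iteratedDeriv (d + 1) f x) x := by
  have hx' : x ∈ Metric.eball (0 : ℝ) r := by simpa [enorm_eq_nnnorm] using hx
  have h := (hp.analyticOnNhd.iterated_deriv d x hx').differentiableAt.hasDerivAt
  rw [iteratedDeriv_succ, iteratedDeriv_eq_iterate]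
  exact h

/-- Termwise differentiation of a power series, to any order. -/
theorem hasSum_derivPow_of_powerSeries (hp : HasFPowerSeriesOnBall f p 0 r) (d : ℕ) :
    ∀ x : ℝ, (‖x‖₊ : ℝ≥0∞) < r →
      HasSum (fun n => p.coeff n * derivPow d n x) (iteratedDeriv d f x) := by
  induction d with
  | zero =>
    intro x hx
    have := hp.hasSum (y := x) (by simpa [enorm_eq_nnnorm] using hx)
    simpa [derivPow_eq, mul_comm] using this
  | succ d ih =>
    intro x hx
    -- Choose |x| < a < b < r: convergence of order d at b majorizes order d + 1 on (-a, a).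
    obtain ⟨a, hxa, har⟩ := ENNReal.lt_iff_exists_nnreal_btwn.1 hx
    obtain ⟨b, hab, hbr⟩ := ENNReal.lt_iff_exists_nnreal_btwn.1 har
    have hxa' : |x| < a := by exact_mod_cast hxa
    have hab' : (a : ℝ) < b := by exact_mod_cast hab
    have hlt : ∀ y ∈ Ioo (-(a : ℝ)) a, (‖y‖₊ : ℝ≥0∞) < r := fun y hy => by
      refine lt_trans ?_ har
      have : |y| < a := abs_lt.2 hy
      exact_mod_cast this
    have hu : Summable fun n => |p.coeff n| * derivPow (d + 1) n a := by
      have h1 := ((ih b (by simpa using hbr)).summable.abs).div_const ((b : ℝ) - a)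
      refine Summable.of_nonneg_of_le (fun n => ?_) (fun n => ?_) h1
      · rw [derivPow_eq]; positivity
      · rw [le_div_iff₀ (by linarith), abs_mul, mul_assoc]
        refine mul_le_mul_of_nonneg_left ?_ (abs_nonneg _)
        exact (derivPow_succ_mul_sub_le d n a.2 hab'.le).trans (le_abs_self _)
    have hbound : ∀ n, ∀ y ∈ Ioo (-(a : ℝ)) a,
        ‖p.coeff n * derivPow (d + 1) n y‖ ≤ |p.coeff n| * derivPow (d + 1) n a := fun n y hy => by
      rw [Real.norm_eq_abs, abs_mul]
      exact mul_le_mul_of_nonneg_left (abs_derivPow_le _ _ (abs_lt.2 hy).le) (abs_nonneg _)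
    have hxI : x ∈ Ioo (-(a : ℝ)) a := abs_lt.1 hxa'
    have h2 := hasDerivAt_tsum_of_isPreconnected hu isOpen_Ioo isPreconnected_Ioo
      (fun n z _ => (hasDerivAt_derivPow d n z).const_mul (p.coeff n)) hbound hxI
      (ih x hx).summable hxI
    have h3 : (fun z => ∑' n, p.coeff n * derivPow d n z) =ᶠ[𝓝 x] iteratedDeriv d f := by
      filter_upwards [isOpen_Ioo.mem_nhds hxI] with z hz using (ih z (hlt z hz)).tsum_eq
    rw [(hasDerivAt_iteratedDeriv_of_powerSeries hp d hx).unique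
      (h2.congr_of_eventuallyEq h3.symm)]
    exact (Summable.of_norm_bounded hu fun n => hbound n x hxI).hasSum

theorem iteratedDeriv_div_factorial (hp : HasFPowerSeriesOnBall f p 0 r) (n : ℕ) :
    iteratedDeriv n f 0 / (n ! : ℝ) = p.coeff n := by
  have h := hasSum_derivPow_of_powerSeries hp n 0 (by simpa using hp.r_pos)
  have h2 : HasSum (fun m => p.coeff m * derivPow n m 0) (p.coeff n * derivPow n n 0) := by
    refine hasSum_single n fun m hm => ?_
    rw [derivPow_eq]
    rcases lt_or_gt_of_ne hm with hlt | hgt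
    · rw [Nat.descFactorial_of_lt hlt]; simp
    · rw [zero_pow (by omega)]; simp
  rw [h.unique h2, derivPow_eq, Nat.descFactorial_self]
  have : (n ! : ℝ) ≠ 0 := by positivity
  simp [this]

theorem hasSum_pow_mulVec (hp : HasFPowerSeriesOnBall f p 0 r) {k : ℕ}
    {A : Matrix (Fin k) (Fin k) ℝ} {μ : ℝ} (hμ : (‖μ‖₊ : ℝ≥0∞) < r) {l : ℕ} {v : Fin k → ℝ}
    (hv : (A - μ • 1) ^ l *ᵥ v = 0) :
    HasSum (fun n : ℕ => ((iteratedDeriv n f 0 / (n ! : ℝ)) • A ^ n) *ᵥ v)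
      (∑ d ∈ Finset.range l, (iteratedDeriv d f μ / (d ! : ℝ)) • ((A - μ • 1) ^ d *ᵥ v)) := by
  have h1 : ∀ n : ℕ, ((iteratedDeriv n f 0 / (n ! : ℝ)) • A ^ n) *ᵥ v = ∑ d ∈ Finset.range l,
      (p.coeff n * derivPow d n μ / (d ! : ℝ)) • ((A - μ • 1) ^ d *ᵥ v) := by
    intro n
    have := aeval_mulVec_of_pow_mulVec_eq_zero hv (X ^ n)
    rw [map_pow, aeval_X] at this
    rw [smul_mulVec, this, iteratedDeriv_div_factorial hp, Finset.smul_sum]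
    simp only [smul_smul, derivPow, mul_div_assoc]
  simp only [h1]
  exact hasSum_sum fun d _ =>
    ((hasSum_derivPow_of_powerSeries hp d μ hμ).div_const _).smul_const _

theorem exists_tendsto_partialSum_of_powerSeries {k : ℕ} {A : Matrix (Fin k) (Fin k) ℝ}
    (hA : A.charpoly.Splits) (hρ : spectralRadius ℝ A ≤ 1) (hf : ContinuousOn f (Icc (-1) 1))
    (ν : AlgebraNorm ℝ (Matrix (Fin k) (Fin k) ℝ)) (habs : Summable fun n => ν (term f A n))
    (hp : HasFPowerSeriesOnBall f p 0 r) (hr : spectralRadius ℝ A < r) :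
    ∃ B : Matrix (Fin k) (Fin k) ℝ,
      HasSum (fun n : ℕ => (iteratedDeriv n f 0 / (n ! : ℝ)) • A ^ n) B ∧
      Tendsto (partialSum f A) atTop (𝓝 B) := by
  have hs : Summable (term f A) := Pi.summable.2 fun i => Pi.summable.2 fun j =>
    summable_linearMap_of_summable_norm ν habs (entryLinearMap ℝ ℝ i j)
  have hB : Tendsto (partialSum f A) atTop (𝓝 (∑' n, term f A n)) :=
    hs.hasSum.tendsto_sum_nat.comp (tendsto_add_atTop_nat 1)
  refine ⟨_, ?_, hB⟩
  refine tendsto_matrix_of_mulVec (span_generalized_eigenvectors_eq_top hA) ?_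
  rintro v ⟨μ, l, hv, hv'⟩
  have hμ := mem_spectrum_of_pow_mulVec hv hv'
  have hμr := (nnnorm_le_spectralRadius_of_mem hμ).trans_lt hr
  -- The ball may not contain [-1, 1], so the derivatives of `f` are available only on `V`, which
  -- contains the eigenvalue.
  have h1 := tendsto_partialSum_mulVec hf ν habs (mem_Icc_of_mem_spectrum hρ hμ) hv hv'
    (V := Metric.eball 0 r) Metric.isOpen_eball (by simpa [enorm_eq_nnnorm] using hμr)
    (F := fun j => iteratedDeriv j f) iteratedDeriv_zero fun j _ y hy =>
      (hasDerivAt_iteratedDeriv_of_powerSeries hp j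
        (by simpa [enorm_eq_nnnorm] using hy.2)).hasDerivWithinAt
  have h2 : Tendsto (fun N => partialSum f A N *ᵥ v) atTop (𝓝 ((∑' n, term f A n) *ᵥ v)) :=
    ((by fun_prop : Continuous fun M : Matrix (Fin k) (Fin k) ℝ => M *ᵥ v).tendsto _).comp hB
  have h3 := hasSum_pow_mulVec hp hμr hv
  rw [tendsto_nhds_unique h2 h1]
  simpa only [HasSum, sum_mulVec] using h3

end PowerSeries

end MatrixChebyshev

theorem mainTheorem2 {k : ℕ} (A : Matrix (Fin k) (Fin k) ℝ)
    -- the spectrum of `A` is real and contained in `[-1, 1]`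
    (hA : A.charpoly.Splits) (hρ : spectralRadius ℝ A ≤ 1)
    (f : ℝ → ℝ) (hf : ContinuousOn f (Icc (-1) 1))
    -- the matrix Chebyshev series converges absolutely, in some sub-multiplicative matrix norm
    (ν : AlgebraNorm ℝ (Matrix (Fin k) (Fin k) ℝ))
    (habs : Summable fun n => ν (MatrixChebyshev.term f A n)) :
    -- the limit is `f(A)` defined through any Jordan form of `A`
    (∀ D : MatrixChebyshev.JordanForm A, MatrixChebyshev.HasDerivatives f (D.maxSize - 1) →
      Tendsto (MatrixChebyshev.partialSum f A) atTop (𝓝 (D.apply f))) ∧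
    -- the limit is `f(A)` defined through the Taylor series of `f`, whenever this is available
    (∀ (p : FormalMultilinearSeries ℝ ℝ ℝ) (r : ℝ≥0∞), HasFPowerSeriesOnBall f p 0 r →
      spectralRadius ℝ A < r →
      ∃ B : Matrix (Fin k) (Fin k) ℝ,
        HasSum (fun n : ℕ => (iteratedDeriv n f 0 / (n ! : ℝ)) • A ^ n) B ∧
        Tendsto (MatrixChebyshev.partialSum f A) atTop (𝓝 B)) := by
  exact ⟨fun D hD => MatrixChebyshev.tendsto_partialSum_jordanForm hρ hf ν habs D hD,
    fun p r hp hr => MatrixChebyshev.exists_tendsto_partialSum_of_powerSeries hA hρ hf ν habs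
      hp hr⟩
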